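/- Let $F$ be a field of characteristic $2$ which is a Kaplansky field, i.e. over which there is, up to $F$-algebra isomorphism, exactly one quaternion division algebra (a quaternion algebra over $F$ is a central simple $F$-algebra of dimension $4$). Let $Q$ be the quaternion division algebra over $F$ and $\gamma$ its canonical involution, $\gamma(x)=\mathrm{Trd}_Q(x)-x$. For an $F$-linear involution $\theta$ on $Q$ put $\mathrm{Alt}(Q,\theta)=\{a-\theta(a)\mid a\in Q\}$. A hermitian form over $(Q,\theta)$ is a finite-dimensional right $Q$-vector space $V$ with a bi-additive map $h:V\times V\to Q$ such that $h(xc,yd)=\theta(c)h(x,y)d$ and $h(y,x)=\theta(h(x,y))$; it is nondegenerate if $h(x,y)=0$ for all $y$ implies $x=0$. A quadratic form over $(Q,\theta)$ is a finite-dimensional right $Q$-vector space $V$ with a map $q:V\to Q/\mathrm{Alt}(Q,\theta)$ such that $q(xd)=\theta(d)q(x)d$ for all $x\in V$, $d\in Q$, and $q(x+y)-q(x)-q(y)=h(x,y)+\mathrm{Alt}(Q,\theta)$ for a (necessarily unique) hermitian form $h$ over $(Q,\theta)$, the polar form of $q$. It is nonsingular if $h$ is nondegenerate, totally singular if $h=0$,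 isotropic if $q(x)=0$ for some $x\neq 0$, and anisotropic otherwise. It is of type $(n,m)$ if it is isometric to the orthogonal sum of a nonsingular quadratic form of dimension $n$ and a totally singular one of dimension $m$ (dimensions over $Q$). Then every quadratic form over $(Q,\gamma)$ of type $(4,0)$ or $(3,1)$ is isotropic. Moreover $\widetilde u(Q)=3$, that is, for every $F$-linear involution $\theta$ on $Q$ the supremum of the dimensions of the anisotropic nonsingular quadratic forms over $(Q,\theta)$ is $3$. -/

import Mathlib

open scoped RightActions

universe u v w

/-- A quaternion algebra over a field `F`: a central simple `F`-algebra of degree `2`, i.e. of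
dimension `2 ^ 2` over `F`. -/
structure IsQuaternionAlgebra (F : Type u) (A : Type v) [Field F] [Ring A] [Algebra F A] :
    Prop where
  central : Algebra.IsCentral F A
  simple : IsSimpleRing A
  finrank_eq : Module.finrank F A = 4

/-- A Kaplansky field: a field over which there is, up to isomorphism of algebras, exactly one
quaternion division algebra. -/
def IsKaplanskyField (F : Type u) [Field F] : Prop :=
  ∃ (Q : Type u) (_ : DivisionRing Q) (_ : Algebra F Q), IsQuaternionAlgebra F Q ∧
    ∀ (Q' : Type u) [DivisionRing Q'] [Algebra F Q'], IsQuaternionAlgebra F Q' →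
      Nonempty (Q' ≃ₐ[F] Q)

/-- An `F`-linear involution on an `F`-algebra `A`. -/
structure FInvolution (F : Type u) (A : Type v) [Field F] [Ring A] [Algebra F A] where
  toLinearMap : A →ₗ[F] A
  map_mul' : ∀ x y : A, toLinearMap (x * y) = toLinearMap y * toLinearMap x
  invol' : ∀ x : A, toLinearMap (toLinearMap x) = x

namespace FInvolution

variable {F : Type u} {A : Type v} [Field F] [Ring A] [Algebra F A]

instance : CoeFun (FInvolution F A) (fun _ => A → A) := ⟨fun θ => θ.toLinearMap⟩

/-- `Alt(A, θ) = {a - θ(a) | a ∈ A}`. -/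
def alt (θ : FInvolution F A) : Submodule F A :=
  LinearMap.range (LinearMap.id - θ.toLinearMap)

/-- The canonical involution `γ` of a quaternion algebra is characterised by the condition that
every `x` is a root of the polynomial `(X - x)(X - γ(x)) = X² - (x + γ(x)) X + γ(x) x` with
coefficients in the base field; these coefficients are the reduced trace (up to sign) and the
reduced norm of `x`, and `γ(x) = Trd(x) - x`. -/
def IsCanonical (γ : FInvolution F A) : Prop :=
  ∀ x : A, ∃ t n : F, x + γ x = algebraMap F A t ∧ γ x * x = algebraMap F A n

theorem conj_mem (θ : FInvolution F A) (d : A) : θ.alt ≤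
    θ.alt.comap ((LinearMap.mulLeft F (θ d)).comp (LinearMap.mulRight F d)) := by
  rintro _ ⟨a, rfl⟩
  refine ⟨θ d * (a * d), ?_⟩
  simp [θ.map_mul', θ.invol', mul_sub, sub_mul, mul_assoc]

/-- The map `A / Alt(A, θ) → A / Alt(A, θ)` induced by `a ↦ θ(d) a d`. -/
def conj (θ : FInvolution F A) (d : A) : (A ⧸ θ.alt) →ₗ[F] (A ⧸ θ.alt) :=
  θ.alt.mapQ θ.alt ((LinearMap.mulLeft F (θ d)).comp (LinearMap.mulRight F d)) (θ.conj_mem d)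

end FInvolution

section Forms

variable {F : Type u} {D : Type v} [Field F] [DivisionRing D] [Algebra F D]

/-- A hermitian form over `(D, θ)` on the right `D`-vector space `V`. -/
structure HermForm (θ : FInvolution F D) (V : Type w) [AddCommGroup V] [Module Dᵐᵒᵖ V] where
  toFun : V → V → D
  add_left' : ∀ x y z, toFun (x + y) z = toFun x z + toFun y z
  add_right' : ∀ x y z, toFun x (y + z) = toFun x y + toFun x z
  smul' : ∀ (x y : V) (c d : D), toFun (x <• c) (y <• d) = θ c * toFun x y * d
  symm' : ∀ x y, toFun y x = θ (toFun x y)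

namespace HermForm

variable {θ : FInvolution F D} {V : Type w} [AddCommGroup V] [Module Dᵐᵒᵖ V]

instance : CoeFun (HermForm θ V) (fun _ => V → V → D) := ⟨toFun⟩

def Nondegenerate (h : HermForm θ V) : Prop :=
  ∀ x, (∀ y, h x y = 0) → x = 0

end HermForm

/-- A quadratic form over `(D, θ)` on the right `D`-vector space `V`. -/
structure QuadForm (θ : FInvolution F D) (V : Type w) [AddCommGroup V] [Module Dᵐᵒᵖ V] where
  toFun : V → D ⧸ θ.alt
  smul' : ∀ (x : V) (d : D), toFun (x <• d) = θ.conj d (toFun x)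
  exists_polar' : ∃ h : HermForm θ V, ∀ x y,
    toFun (x + y) - toFun x - toFun y = θ.alt.mkQ (h x y)

namespace QuadForm

variable {θ : FInvolution F D} {V : Type w} [AddCommGroup V] [Module Dᵐᵒᵖ V]
  {W : Type w} [AddCommGroup W] [Module Dᵐᵒᵖ W]

instance : CoeFun (QuadForm θ V) (fun _ => V → D ⧸ θ.alt) := ⟨toFun⟩

/-- The polar form of a quadratic form; it is unique by `polar_unique`. -/
noncomputable def polar (q : QuadForm θ V) : HermForm θ V := q.exists_polar'.choose

theorem polar_spec (q : QuadForm θ V) (x y : V) :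
    q (x + y) - q x - q y = θ.alt.mkQ (q.polar x y) := q.exists_polar'.choose_spec x y

theorem polar_unique (q : QuadForm θ V) (h : HermForm θ V)
    (hh : ∀ x y, q (x + y) - q x - q y = θ.alt.mkQ (h x y)) (x y : V) : h x y = q.polar x y := by
  have key : ∀ y, h x y - q.polar x y ∈ θ.alt := fun y => by
    rw [← Submodule.ker_mkQ θ.alt, LinearMap.mem_ker, map_sub, ← hh, ← polar_spec, sub_self]
  by_contra hne
  set c := h x y - q.polar x y with hc
  have hc0 : c ≠ 0 := sub_ne_zero.mpr hne
  have h1 : θ 1 = 1 := by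
    have := θ.map_mul' 1 (θ 1)
    rwa [one_mul, θ.invol', one_mul, eq_comm] at this
  have all : ∀ a : D, a ∈ θ.alt := fun a => by
    have e : ∀ g : HermForm θ V, g x (y <• (c⁻¹ * a)) = g x y * (c⁻¹ * a) := fun g => by
      have := g.smul' x y 1 (c⁻¹ * a)
      simpa [h1] using this
    have := key (y <• (c⁻¹ * a))
    rwa [e, e, ← sub_mul, ← hc, mul_inv_cancel_left₀ hc0] at this
  have neg : ∀ a : D, θ a = -a := fun a => by
    obtain ⟨b, rfl⟩ := all a
    simp [θ.invol']
  obtain ⟨a, ha⟩ := all 1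
  have h2 : (1 : D) + 1 = 0 := by
    have := neg 1
    rw [h1] at this
    nth_rewrite 2 [this]
    exact add_neg_cancel 1
  have h3 : a + a = 1 := by simpa [neg] using ha
  have h4 : a + a = (1 + 1) * a := by rw [add_mul, one_mul]
  rw [h4, h2, zero_mul] at h3
  exact zero_ne_one h3

/-- `q` represents `0`. -/
def Isotropic (q : QuadForm θ V) : Prop := ∃ x : V, x ≠ 0 ∧ q x = 0

def Nonsingular (q : QuadForm θ V) : Prop := q.polar.Nondegenerate

def TotallySingular (q : QuadForm θ V) : Prop := ∀ x y, q.polar x y = 0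

def Isometric (q₁ : QuadForm θ V) (q₂ : QuadForm θ W) : Prop :=
  ∃ e : V ≃ₗ[Dᵐᵒᵖ] W, ∀ x, q₁ x = q₂ (e x)

/-- The orthogonal sum of two quadratic forms. -/
def orthSum (q₁ : QuadForm θ V) (q₂ : QuadForm θ W) : QuadForm θ (V × W) where
  toFun x := q₁ x.1 + q₂ x.2
  smul' x d := by simp [q₁.smul', q₂.smul']
  exists_polar' := by
    refine ⟨⟨fun x y => q₁.polar x.1 y.1 + q₂.polar x.2 y.2, ?_, ?_, ?_, ?_⟩, ?_⟩
    · intro x y z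
      simp only [Prod.fst_add, Prod.snd_add, HermForm.add_left']
      abel
    · intro x y z
      simp only [Prod.fst_add, Prod.snd_add, HermForm.add_right']
      abel
    · intro x y c d
      simp only [Prod.smul_fst, Prod.smul_snd, HermForm.smul', mul_add, add_mul]
    · intro x y
      simp only [map_add]
      rw [q₁.polar.symm', q₂.polar.symm']
    · intro x y
      simp only [Prod.fst_add, Prod.snd_add, map_add, ← polar_spec]
      abel

/-- `q` is of type `(n, m)`: it is isometric to the orthogonal sum of a nonsingular form of
dimension `n` and a totally singular form of dimension `m`. -/
def HasType (q : QuadForm θ V) (n m : ℕ) : Prop :=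
  ∃ (V₁ V₂ : Type w) (_ : AddCommGroup V₁) (_ : AddCommGroup V₂)
    (_ : Module Dᵐᵒᵖ V₁) (_ : Module Dᵐᵒᵖ V₂)
    (_ : Module.Finite Dᵐᵒᵖ V₁) (_ : Module.Finite Dᵐᵒᵖ V₂)
    (q₁ : QuadForm θ V₁) (q₂ : QuadForm θ V₂),
    q₁.Nonsingular ∧ Module.finrank Dᵐᵒᵖ V₁ = n ∧
    q₂.TotallySingular ∧ Module.finrank Dᵐᵒᵖ V₂ = m ∧
    q.Isometric (q₁.orthSum q₂)

end QuadForm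
/-- The supremum of the dimensions of the anisotropic nonsingular quadratic forms over `(D, θ)`.
(Every finite-dimensional right `D`-vector space has an isomorphic copy in the universe of `D`.) -/
noncomputable def uTilde (θ : FInvolution F D) : ℕ∞ :=
  sSup {n : ℕ∞ | ∃ (V : Type v) (_ : AddCommGroup V) (_ : Module Dᵐᵒᵖ V)
    (_ : Module.Finite Dᵐᵒᵖ V) (q : QuadForm θ V),
    q.Nonsingular ∧ ¬ q.Isotropic ∧ n = (Module.finrank Dᵐᵒᵖ V : ℕ∞)}

end Forms

/-!
Over `(Q, γ)` the submodule `Alt(Q, γ)` is `F`, and every nonsymmetric element of `Q` is a scalar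
multiple of an Artin–Schreier element `u`, one with `γ u = u + 1` and `u² + u = δ ∈ F`.
Nonsingular forms are therefore orthogonal sums of one-dimensional forms `⟨tᵢ uᵢ⟩`. As `Q` is the
only quaternion division algebra over `F`, the symbol `[a, c)` takes just two values, and so it
becomes an `𝔽₂`-bilinear pairing. Call `a` radical if `[a, c)` splits for all `c`. Parameters of
Artin–Schreier elements are never radical, and three nonradical classes whose sum is nonradical
share a slot `c` for which none of the three symbols splits.

The heart of the matter is that a ternary form `⟨t₁ u₁, t₂ u₂, t₃ u₃⟩` is isotropic if and only if
`δ₁ + δ₂ + δ₃` is not radical. For a quaternary form this provides a common value of its two binary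
halves, and for type `(3, 1)` the symmetric entry serves to modify `δ₃` until the criterion
applies. The criterion also produces an anisotropic ternary form, with parameters `δ`, `ε` and
`δ + ε`. An arbitrary involution of `Q` is `Int(s) ∘ γ` for some `s` with `γ s = s`, and
multiplication by `s` identifies forms over `(Q, γ)` with forms over `(Q, Int(s) ∘ γ)`.
-/

section Symbol

variable {F : Type u} [Field F]

/-- The norm form `X² + XY + aY²` of the algebra `F[T]/(T² + T + a)` in characteristic two. -/
def artinSchreierNorm (a x y : F) : F := x ^ 2 + x * y + a * y ^ 2

theorem artinSchreierNorm_mul [CharP F 2] (a x y z w : F) :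
    artinSchreierNorm a x y * artinSchreierNorm a z w =
      artinSchreierNorm a (x * z + a * y * w) (x * w + y * z + y * w) := by
  simp only [artinSchreierNorm]
  grind

variable [CharP F 2]

/-- The Artin–Schreier slots `a` for which the quaternion algebra `[a, c)` of a field of
characteristic two is split: the kernel of the symbol `[·, c)`. -/
def symbolKer (c : F) : AddSubgroup F where
  carrier := {a | ∃ x y : F, a = c * x ^ 2 + (y ^ 2 + y)}
  zero_mem' := ⟨0, 0, by simp⟩
  add_mem' := by
    rintro _ _ ⟨x, y, rfl⟩ ⟨z, w, rfl⟩
    exact ⟨x + z, y + w, by rw [CharTwo.add_sq, CharTwo.add_sq]; ring⟩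
  neg_mem' := by simp only [CharTwo.neg_eq, imp_self, implies_true]

theorem mem_symbolKer {a c : F} : a ∈ symbolKer c ↔ ∃ x y : F, a = c * x ^ 2 + (y ^ 2 + y) :=
  Iff.rfl

theorem mem_symbolKer_iff_exists_norm {a c : F} (hc : c ≠ 0) :
    a ∈ symbolKer c ↔ ∃ x y : F, c = artinSchreierNorm a x y := by
  simp only [mem_symbolKer, artinSchreierNorm]
  constructor
  · rintro ⟨x, y, rfl⟩
    by_cases hx : x = 0
    · exact ⟨c + y * (1 + c), 1 + c, by grind⟩
    · exact ⟨y / x, 1 / x, by grind⟩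
  · rintro ⟨x, y, h⟩
    by_cases hy : y = 0
    · exact ⟨a / x, a, by grind⟩
    · exact ⟨1 / y, x / y, by grind⟩

theorem mem_symbolKer_mul {a c d : F} (hc : c ≠ 0) (hd : d ≠ 0) (h : a ∈ symbolKer c)
    (h' : a ∈ symbolKer d) : a ∈ symbolKer (c * d) := by
  rw [mem_symbolKer_iff_exists_norm hc] at h
  rw [mem_symbolKer_iff_exists_norm hd] at h'
  rw [mem_symbolKer_iff_exists_norm (mul_ne_zero hc hd)]
  obtain ⟨x, y, rfl⟩ := h
  obtain ⟨z, w, rfl⟩ := h'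
  exact ⟨_, _, artinSchreierNorm_mul a x y z w⟩

theorem symbolKer_mul_sq (c : F) {r : F} (hr : r ≠ 0) : symbolKer (c * r ^ 2) = symbolKer c := by
  ext a
  refine ⟨fun ⟨x, y, h⟩ => ⟨r * x, y, by rw [h]; ring⟩, fun ⟨x, y, h⟩ => ⟨x / r, y, ?_⟩⟩
  rw [h]
  field_simp

variable (F) in
/-- The Artin–Schreier slots `a` for which the quaternion algebra `[a, c)` splits for every
`c ≠ 0`. -/
def symbolRadical : AddSubgroup F := ⨅ c : Fˣ, symbolKer (c : F)

theorem mem_symbolRadical {a : F} : a ∈ symbolRadical F ↔ ∀ c : Fˣ, a ∈ symbolKer (c : F) :=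
  AddSubgroup.mem_iInf

theorem notMem_symbolRadical {a : F} :
    a ∉ symbolRadical F ↔ ∃ c : Fˣ, a ∉ symbolKer (c : F) := by
  rw [mem_symbolRadical, not_forall]

variable (F) in
/-- The symbol `[a, c)` takes at most two values in each of its slots. -/
structure IsTwoValuedSymbol : Prop where
  add_mem_iff : ∀ (a b : F) (c : Fˣ),
    a + b ∈ symbolKer (c : F) ↔ (a ∈ symbolKer (c : F) ↔ b ∈ symbolKer (c : F))
  mul_mem_iff : ∀ (a : F) (c d : Fˣ),
    a ∈ symbolKer ((c * d : Fˣ) : F) ↔ (a ∈ symbolKer (c : F) ↔ a ∈ symbolKer (d : F))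

namespace IsTwoValuedSymbol

theorem exists_notMem_pair (H : IsTwoValuedSymbol F) {a b : F} (ha : a ∉ symbolRadical F)
    (hb : b ∉ symbolRadical F) :
    ∃ c : Fˣ, a ∉ symbolKer (c : F) ∧ b ∉ symbolKer (c : F) := by
  rw [notMem_symbolRadical] at ha hb
  obtain ⟨c, hac⟩ := ha
  obtain ⟨d, hbd⟩ := hb
  by_contra! h
  have hc := h c
  have hd := h d
  have hcd := h (c * d)
  rw [H.mul_mem_iff, H.mul_mem_iff] at hcd
  tauto

theorem exists_notMem_triple (H : IsTwoValuedSymbol F) {a b d : F} (ha : a ∉ symbolRadical F)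
    (hb : b ∉ symbolRadical F) (hd : d ∉ symbolRadical F) (habd : a + b + d ∉ symbolRadical F) :
    ∃ c : Fˣ, a ∉ symbolKer (c : F) ∧ b ∉ symbolKer (c : F) ∧ d ∉ symbolKer (c : F) := by
  obtain ⟨p, hpa, hpb⟩ := H.exists_notMem_pair ha hb
  obtain ⟨q, hqa, hqd⟩ := H.exists_notMem_pair ha hd
  obtain ⟨r, hrb, hrd⟩ := H.exists_notMem_pair hb hd
  obtain ⟨s, hs⟩ := notMem_symbolRadical.1 habd
  rw [H.add_mem_iff, H.add_mem_iff] at hs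
  by_contra! h
  have hps := h (p * s)
  have hqs := h (q * s)
  have hrs := h (r * s)
  simp only [H.mul_mem_iff] at hps hqs hrs
  grind

end IsTwoValuedSymbol

end Symbol

section Canonical

variable {F : Type u} [Field F] {Q : Type v} [DivisionRing Q] [Algebra F Q]

namespace FInvolution

theorem map_one (θ : FInvolution F Q) : θ 1 = 1 := by
  have := θ.map_mul' 1 (θ 1)
  rwa [one_mul, θ.invol', one_mul, eq_comm] at this

theorem map_smul_one (θ : FInvolution F Q) (r : F) : θ (r • 1) = r • 1 := by
  rw [map_smul, θ.map_one]

theorem map_ne_zero (θ : FInvolution F Q) {x : Q} (hx : x ≠ 0) : θ x ≠ 0 := fun h =>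
  hx (by rw [← θ.invol' x, h, map_zero])

end FInvolution

theorem smul_one_injective : Function.Injective fun r : F => r • (1 : Q) :=
  smul_left_injective F one_ne_zero

theorem charP_two_of_algebra (F : Type u) (Q : Type v) [Field F] [DivisionRing Q] [Algebra F Q]
    [CharP F 2] : CharP Q 2 :=
  charP_of_injective_algebraMap (algebraMap F Q).injective 2

theorem exists_eq_smul_one_of_commute [Algebra.IsCentral F Q] {x : Q} (hx : ∀ m, x * m = m * x) :
    ∃ r : F, x = r • 1 := by
  have hx' : x ∈ Subalgebra.center F Q := Subalgebra.mem_center_iff.2 fun m => (hx m).symm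
  rw [Algebra.IsCentral.center_eq_bot, Algebra.mem_bot] at hx'
  obtain ⟨r, rfl⟩ := hx'
  exact ⟨r, Algebra.algebraMap_eq_smul_one r⟩

variable {γ : FInvolution F Q}

namespace FInvolution.IsCanonical

theorem exists_map_mul_self (hγ : γ.IsCanonical) (x : Q) : ∃ n : F, γ x * x = n • 1 := by
  obtain ⟨-, n, -, hn⟩ := hγ x
  exact ⟨n, by rw [hn, Algebra.algebraMap_eq_smul_one]⟩

theorem exists_norm_ne_zero (hγ : γ.IsCanonical) {x : Q} (hx : x ≠ 0) :
    ∃ n : F, n ≠ 0 ∧ γ x * x = n • 1 ∧ x * γ x = n • 1 := by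
  obtain ⟨n, hn⟩ := hγ.exists_map_mul_self x
  refine ⟨n, ?_, hn, mul_right_cancel₀ hx ?_⟩
  · rintro rfl
    rw [zero_smul] at hn
    exact mul_ne_zero (γ.map_ne_zero hx) hx hn
  · rw [mul_assoc, hn, mul_smul_comm, mul_one, smul_one_mul]

end FInvolution.IsCanonical

variable [CharP F 2]

theorem exists_conj_of_mul_self {x y : Q} {t n : F} (hx : x * x = t • x + n • 1)
    (hy : y * y = t • y + n • 1) (hc : ∃ m, x * m ≠ m * x) :
    ∃ g : Q, g ≠ 0 ∧ y * g = g * x := by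
  have := charP_two_of_algebra F Q
  have intertwines : ∀ m : Q, y * (y * m + m * x + t • m) = (y * m + m * x + t • m) * x := by
    intro m
    have hyy : y * (y * m) = t • (y * m) + n • m := by
      rw [← mul_assoc, hy, add_mul, smul_mul_assoc, smul_one_mul]
    simp only [mul_add, add_mul, mul_assoc, hx, hyy, mul_smul_comm, smul_mul_assoc, mul_one]
    match_scalars <;> grind
  by_contra! h
  have vanishes : ∀ m, y * m + m * x + t • m = 0 := fun m =>
    by_contra fun hm => h _ hm (intertwines m)
  obtain ⟨m, hm⟩ := hc
  have hyx : y = x + t • 1 := by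
    rw [← CharTwo.add_eq_zero, ← add_assoc]
    simpa using vanishes 1
  apply hm
  rw [← CharTwo.add_eq_zero, ← vanishes m, hyx]
  simp only [add_mul, smul_mul_assoc, one_mul]
  match_scalars <;> grind

namespace FInvolution.IsCanonical

theorem exists_map_eq_add (hγ : γ.IsCanonical) (x : Q) : ∃ t : F, γ x = x + t • 1 := by
  have := charP_two_of_algebra F Q
  obtain ⟨t, -, ht, -⟩ := hγ x
  exact ⟨t, by rw [← Algebra.algebraMap_eq_smul_one, ← ht, CharTwo.add_cancel_left]⟩

theorem map_mul_add_mul (hγ : γ.IsCanonical) (x y : Q) : γ (x * y + y * x) = x * y + y * x := by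
  obtain ⟨s, hs⟩ := hγ.exists_map_eq_add x
  obtain ⟨t, ht⟩ := hγ.exists_map_eq_add y
  rw [map_add, γ.map_mul', γ.map_mul', hs, ht]
  simp only [mul_add, add_mul, mul_smul_comm, smul_mul_assoc, one_mul, mul_one]
  match_scalars <;> grind

theorem map_eq_add_one (hγ : γ.IsCanonical) {i z : Q} (hz : z ≠ 0) (h : z * i = i * z + z) :
    γ i = i + 1 := by
  obtain ⟨t, ht⟩ := hγ.exists_map_eq_add i
  obtain ⟨n, hn⟩ := hγ.exists_map_mul_self i
  have hi : i * i + t • i = n • 1 := by rw [← hn, ht, add_mul, smul_one_mul]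
  have hzi : z * (i * i + t • i) = (i * i + t • i) * z + (1 + t) • z := by
    simp only [mul_add, add_mul, ← mul_assoc, mul_smul_comm, smul_mul_assoc, h]
    simp only [mul_assoc, h]
    simp only [mul_add]
    match_scalars <;> grind
  rw [hi, mul_smul_comm, mul_one, smul_one_mul, left_eq_add, smul_eq_zero, CharTwo.add_eq_zero]
    at hzi
  rw [ht, ← hzi.resolve_right hz, one_smul]

theorem exists_smul_add_of_commute (hγ : γ.IsCanonical) {i e : Q} (hi : γ i = i + 1)
    (he : e * i = i * e) : ∃ p q : F, e = p • 1 + q • i := by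
  obtain ⟨t, ht⟩ := hγ.exists_map_eq_add e
  obtain ⟨p, hp⟩ := hγ.exists_map_eq_add ((e + t • i) * i)
  refine ⟨p, t, ?_⟩
  rw [γ.map_mul', map_add, map_smul, hi, ht, add_mul, mul_add] at hp
  simp only [mul_add, add_mul, smul_mul_assoc, mul_smul_comm, one_mul, mul_one, he, smul_add] at hp
  linear_combination (norm := skip) hp
  match_scalars <;> grind

end FInvolution.IsCanonical

end Canonical

section SymbolPair

/-- `u` is an Artin–Schreier element with parameter `δ`: it has trace `1` and `u² + u = δ`. -/
structure IsArtinSchreier {F : Type u} {Q : Type v} [Field F] [DivisionRing Q] [Algebra F Q]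
    (γ : FInvolution F Q) (u : Q) (δ : F) : Prop where
  map_eq : γ u = u + 1
  mul_self : u * u = u + δ • 1

/-- `i` and `j` generate a copy of the quaternion algebra `[a, c)` of characteristic two. -/
structure IsSymbolPair {F : Type u} {Q : Type v} [Field F] [DivisionRing Q] [Algebra F Q]
    (a : F) (c : Fˣ) (i j : Q) : Prop where
  ii : i * i = i + a • 1
  ji : j * i = i * j + j
  jj : j * j = (c : F) • 1

variable {F : Type u} [Field F] {Q : Type v} [DivisionRing Q] [Algebra F Q] {γ : FInvolution F Q}

theorem eq_zero_of_smul_add_smul_one {x : Q} (hx : ∀ r : F, x ≠ r • 1) {p q : F}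
    (h : p • 1 + q • x = 0) : p = 0 ∧ q = 0 := by
  have hq : q = 0 := by
    by_contra hq
    apply hx (-(q⁻¹ * p))
    rw [neg_smul, mul_smul, ← smul_neg, ← eq_neg_of_add_eq_zero_right h, inv_smul_smul₀ hq]
  subst hq
  simpa using h

namespace IsArtinSchreier

variable {u : Q} {δ : F}

theorem mul_self_mul (h : IsArtinSchreier γ u δ) (x : Q) : u * (u * x) = u * x + δ • x := by
  rw [← mul_assoc, h.mul_self, add_mul, smul_one_mul]

theorem ne_smul_one (h : IsArtinSchreier γ u δ) (r : F) : u ≠ r • 1 := by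
  rintro rfl
  simpa [γ.map_one] using h.map_eq

theorem exists_conj (h : IsArtinSchreier γ u δ) (hγ : γ.IsCanonical) {d : Q} (hd : d ≠ 0) :
    ∃ (s : F) (x : Q), s ≠ 0 ∧ IsArtinSchreier γ x δ ∧ γ d * u * d = s • x := by
  obtain ⟨n, hn, hγd, hdγ⟩ := hγ.exists_norm_ne_zero hd
  refine ⟨n, n⁻¹ • (γ d * u * d), hn, ⟨?_, ?_⟩, (smul_inv_smul₀ hn _).symm⟩
  · rw [map_smul, γ.map_mul', γ.map_mul', γ.invol', h.map_eq, add_mul, mul_add, one_mul, hγd,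
      smul_add, inv_smul_smul₀ hn, mul_assoc]
  · calc n⁻¹ • (γ d * u * d) * n⁻¹ • (γ d * u * d)
        = (n⁻¹ * n⁻¹) • (γ d * (u * ((d * γ d) * (u * d)))) := by
          simp only [smul_mul_smul_comm, mul_assoc]
      _ = n⁻¹ • (γ d * (u * u) * d) := by
          rw [hdγ, smul_one_mul, mul_smul_comm, mul_smul_comm, mul_smul, inv_smul_smul₀ hn]
          simp only [mul_assoc]
      _ = n⁻¹ • (γ d * u * d) + δ • 1 := by
          rw [h.mul_self, mul_add, add_mul, mul_smul_comm, mul_one, smul_mul_assoc, hγd, smul_add,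
            smul_comm δ, inv_smul_smul₀ hn]

end IsArtinSchreier

theorem FInvolution.IsCanonical.exists_isArtinSchreier [CharP F 2] (hγ : γ.IsCanonical) {u : Q}
    (hu : γ u = u + 1) : ∃ δ : F, IsArtinSchreier γ u δ := by
  have := charP_two_of_algebra F Q
  obtain ⟨n, hn⟩ := hγ.exists_map_mul_self u
  rw [hu, add_mul, one_mul] at hn
  exact ⟨n, hu, by rw [← hn, add_comm (u * u), CharTwo.add_cancel_left]⟩

namespace IsSymbolPair

variable {a : F} {c d : Fˣ} {i j k : Q}

theorem ii_mul (P : IsSymbolPair a c i j) (x : Q) : i * (i * x) = i * x + a • x := by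
  rw [← mul_assoc, P.ii, add_mul, smul_one_mul]

theorem ji_mul (P : IsSymbolPair a c i j) (x : Q) : j * (i * x) = i * (j * x) + j * x := by
  rw [← mul_assoc, P.ji, add_mul, mul_assoc]

theorem jj_mul (P : IsSymbolPair a c i j) (x : Q) : j * (j * x) = (c : F) • x := by
  rw [← mul_assoc, P.jj, smul_one_mul]

theorem ne_zero (P : IsSymbolPair a c i j) : j ≠ 0 := by
  rintro rfl
  simpa using P.jj.symm

theorem not_commute (P : IsSymbolPair a c i j) : i * j ≠ j * i := by
  simp [P.ji, P.ne_zero]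

theorem conj (P : IsSymbolPair a c i j) {g : Q} (hg : g ≠ 0) :
    IsSymbolPair a c (g⁻¹ * i * g) (g⁻¹ * j * g) := by
  have conj_mul : ∀ x y : Q, (g⁻¹ * x * g) * (g⁻¹ * y * g) = g⁻¹ * (x * y) * g := fun x y => by
    simp only [mul_assoc, mul_inv_cancel_left₀ hg]
  refine ⟨?_, ?_, ?_⟩
  · rw [conj_mul, P.ii, mul_add, add_mul, mul_smul_comm, smul_mul_assoc, mul_one,
      inv_mul_cancel₀ hg]
  · rw [conj_mul, conj_mul, P.ji, mul_add, add_mul]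
  · rw [conj_mul, P.jj, mul_smul_comm, smul_mul_assoc, mul_one, inv_mul_cancel₀ hg]

theorem right_ne_smul_one (P : IsSymbolPair a c i j) (r : F) : j ≠ r • 1 := by
  rintro rfl
  simpa using P.not_commute

variable [CharP F 2]

theorem map (P : IsSymbolPair a c i j) (θ : FInvolution F Q) : IsSymbolPair a c (θ i) (θ j) := by
  have := charP_two_of_algebra F Q
  refine ⟨?_, ?_, ?_⟩
  · rw [← θ.map_mul', P.ii, map_add, θ.map_smul_one]
  · rw [← θ.map_mul', ← θ.map_mul', P.ji, map_add, CharTwo.add_cancel_right]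
  · rw [← θ.map_mul', P.jj, θ.map_smul_one]

theorem isArtinSchreier (P : IsSymbolPair a c i j) (hγ : γ.IsCanonical) :
    IsArtinSchreier γ i a :=
  ⟨hγ.map_eq_add_one P.ne_zero P.ji, P.ii⟩

theorem map_right (P : IsSymbolPair a c i j) (hγ : γ.IsCanonical) : γ j = j := by
  have := charP_two_of_algebra F Q
  have hj : i * j + j * i = j := by rw [P.ji, CharTwo.add_cancel_left]
  rw [← hj, hγ.map_mul_add_mul]

/-- The reduced norm of `x + y i + j` would vanish if `[a, c)` were split. -/
theorem notMem_symbolKer (P : IsSymbolPair a c i j) (hγ : γ.IsCanonical) :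
    a ∉ symbolKer (c : F) := by
  have := charP_two_of_algebra F Q
  rw [mem_symbolKer_iff_exists_norm c.ne_zero]
  rintro ⟨x, y, h⟩
  have norm_eq_zero : (x • 1 + y • i + j) * γ (x • 1 + y • i + j) = 0 := by
    simp only [map_add, map_smul, γ.map_one, (P.isArtinSchreier hγ).map_eq, P.map_right hγ]
    simp only [mul_add, add_mul, smul_mul_assoc, mul_smul_comm, one_mul, mul_one, P.ii, P.ji, P.jj,
      smul_add, h, artinSchreierNorm]
    match_scalars <;> grind
  have hj : x • 1 + y • i = j := by
    rw [← CharTwo.add_eq_zero]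
    by_contra hne
    exact mul_ne_zero hne (γ.map_ne_zero hne) norm_eq_zero
  apply P.not_commute
  simp only [← hj, mul_add, add_mul, smul_mul_assoc, mul_smul_comm, one_mul, mul_one]

theorem exists_conj_left {i' j' : Q} (P : IsSymbolPair a c i j) (P' : IsSymbolPair a d i' j') :
    ∃ k, IsSymbolPair a d i k := by
  obtain ⟨g, hg, h⟩ := exists_conj_of_mul_self (x := i) (y := i') (t := 1) (n := a)
    (by rw [P.ii, one_smul]) (by rw [P'.ii, one_smul]) ⟨j, P.not_commute⟩
  refine ⟨g⁻¹ * j' * g, ?_⟩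
  have := P'.conj hg
  rwa [mul_assoc _ i', h, inv_mul_cancel_left₀ hg] at this

theorem exists_conj_right {b : F} {i' j' : Q} (P : IsSymbolPair a c i j)
    (P' : IsSymbolPair b c i' j') : ∃ k, IsSymbolPair b c k j := by
  obtain ⟨g, hg, h⟩ := exists_conj_of_mul_self (x := j) (y := j') (t := 0) (n := (c : F))
    (by rw [P.jj, zero_smul, zero_add]) (by rw [P'.jj, zero_smul, zero_add])
    ⟨i, P.not_commute.symm⟩
  refine ⟨g⁻¹ * i' * g, ?_⟩
  have := P'.conj hg
  rwa [mul_assoc _ j', h, inv_mul_cancel_left₀ hg] at this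

theorem exists_eq_smul_add_mul_of_mul_eq {e : Q} (P : IsSymbolPair a c i j) (hγ : γ.IsCanonical)
    (he : e * i = i * e + e) : ∃ x y : F, e = (x • 1 + y • i) * j := by
  have := charP_two_of_algebra F Q
  have hcomm : e * j * i = i * (e * j) := by
    rw [mul_assoc, P.ji, mul_add, ← mul_assoc, he, add_mul, CharTwo.add_cancel_right, mul_assoc]
  obtain ⟨x, y, h⟩ := hγ.exists_smul_add_of_commute (P.isArtinSchreier hγ).map_eq hcomm
  refine ⟨(c : F)⁻¹ * x, (c : F)⁻¹ * y, ?_⟩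
  rw [mul_smul, mul_smul, ← smul_add, ← h, smul_mul_assoc, mul_assoc, P.jj, mul_smul_comm, mul_one,
    inv_smul_smul₀ c.ne_zero]

theorem exists_eq_add_mul (P : IsSymbolPair a c i j) (hγ : γ.IsCanonical) (x : Q) :
    ∃ p q r s : F, x = p • 1 + q • i + (r • 1 + s • i) * j := by
  have := charP_two_of_algebra F Q
  have hodd : (i * x + x * i) * i = i * (i * x + x * i) + (i * x + x * i) := by
    simp only [mul_add, add_mul, mul_assoc, P.ii, P.ii_mul, mul_one, mul_smul_comm]
    match_scalars <;> grind
  have heven : (x + (i * x + x * i)) * i = i * (x + (i * x + x * i)) := by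
    simp only [mul_add, add_mul, mul_assoc, P.ii, P.ii_mul, mul_one, mul_smul_comm]
    match_scalars <;> grind
  obtain ⟨p, q, hpq⟩ := hγ.exists_smul_add_of_commute (P.isArtinSchreier hγ).map_eq heven
  obtain ⟨r, s, hrs⟩ := P.exists_eq_smul_add_mul_of_mul_eq hγ hodd
  exact ⟨p, q, r, s, by rw [← hpq, ← hrs, CharTwo.add_cancel_right]⟩

theorem exists_eq_smul_add_mul (P : IsSymbolPair a c i j) (P' : IsSymbolPair a d i k)
    (hγ : γ.IsCanonical) : ∃ x y : F, k = (x • 1 + y • i) * j :=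
  P.exists_eq_smul_add_mul_of_mul_eq hγ P'.ji

theorem exists_eq_smul_add_of_commute {e : Q} (P : IsSymbolPair a c i j) (hγ : γ.IsCanonical)
    (he : j * e = e * j) : ∃ x y : F, e = x • 1 + y • j := by
  obtain ⟨p, q, r, s, rfl⟩ := P.exists_eq_add_mul hγ e
  have hqs : (q • 1 + s • j) * j = 0 := by
    simp only [mul_add, add_mul, mul_smul_comm, smul_mul_assoc, one_mul, mul_one, mul_assoc,
      P.ji, P.ji_mul, P.jj] at he ⊢
    linear_combination (norm := skip) he
    match_scalars <;> grind
  have hqs' : q • 1 + s • j = 0 := (mul_eq_zero.1 hqs).resolve_right P.ne_zero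
  obtain ⟨rfl, rfl⟩ := eq_zero_of_smul_add_smul_one P.right_ne_smul_one hqs'
  exact ⟨p, r, by simp⟩

theorem exists_eq_add (P : IsSymbolPair a c i j) {b : F} (P' : IsSymbolPair b c k j)
    (hγ : γ.IsCanonical) : ∃ x y : F, k = i + x • 1 + y • j := by
  have := charP_two_of_algebra F Q
  have hcomm : j * (i + k) = (i + k) * j := by
    rw [mul_add, add_mul, P.ji, P'.ji, add_add_add_comm, CharTwo.add_self_eq_zero, add_zero]
  obtain ⟨x, y, h⟩ := P.exists_eq_smul_add_of_commute hγ hcomm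
  exact ⟨x, y, by rw [add_assoc, ← h, CharTwo.add_cancel_left]⟩

theorem exists_conj {i' j' : Q} (P : IsSymbolPair a c i j) (P' : IsSymbolPair a c i' j') :
    ∃ u : Q, u ≠ 0 ∧ i' * u = u * i ∧ j' * u = u * j := by
  have := charP_two_of_algebra F Q
  obtain ⟨g, hg, hgi⟩ := exists_conj_of_mul_self (x := i) (y := i') (t := 1) (n := a)
    (by rw [P.ii, one_smul]) (by rw [P'.ii, one_smul]) ⟨j, P.not_commute⟩
  by_cases hgj : j' * g = g * j
  · exact ⟨g, hg, hgi, hgj⟩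
  refine ⟨(j' * g + g * j) * j, mul_ne_zero ?_ P.ne_zero, ?_, ?_⟩
  · rwa [Ne, CharTwo.add_eq_zero]
  · have hi'j' : i' * (j' * g) = j' * (g * i) + j' * g := by
      rw [← hgi, ← mul_assoc j', P'.ji, add_mul, mul_assoc i', CharTwo.add_cancel_right]
    rw [← mul_assoc, mul_add, hi'j', ← mul_assoc i', hgi]
    simp only [add_mul, mul_add, mul_assoc, P.ji, P.ji_mul, CharTwo.add_cancel_right]
  · simp only [add_mul, mul_add, mul_assoc, P.jj, P'.jj_mul, mul_smul_comm, mul_one]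
    rw [smul_mul_assoc, add_comm]

end IsSymbolPair

section Central

variable [CharP F 2] [Algebra.IsCentral F Q]

theorem IsArtinSchreier.exists_isSymbolPair {u : Q} {δ : F} (h : IsArtinSchreier γ u δ)
    (hγ : γ.IsCanonical) : ∃ (c : Fˣ) (j : Q), IsSymbolPair δ c u j := by
  obtain ⟨m, hm⟩ : ∃ m, u * m ≠ m * u := by
    by_contra! hu
    obtain ⟨r, hr⟩ := exists_eq_smul_one_of_commute (F := F) hu
    exact h.ne_smul_one r hr
  have := charP_two_of_algebra F Q
  have hj : u * m + m * u ≠ 0 := by rwa [Ne, CharTwo.add_eq_zero]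
  obtain ⟨c, hc, hcj, -⟩ := hγ.exists_norm_ne_zero hj
  rw [hγ.map_mul_add_mul] at hcj
  refine ⟨Units.mk0 c hc, u * m + m * u, h.mul_self, ?_, hcj⟩
  simp only [mul_add, add_mul, mul_assoc, h.mul_self, h.mul_self_mul, mul_smul_comm, mul_one]
  match_scalars <;> grind

theorem exists_isSymbolPair_of_map_eq {z : Q} (hγ : γ.IsCanonical) (hz : γ z = z)
    (hzF : ∀ r : F, z ≠ r • 1) : ∃ (a : F) (c : Fˣ) (i : Q), IsSymbolPair a c i z := by
  obtain ⟨m, hm⟩ : ∃ m, z * m ≠ m * z := by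
    by_contra! hz
    obtain ⟨r, hr⟩ := exists_eq_smul_one_of_commute (F := F) hz
    exact hzF r hr
  have := charP_two_of_algebra F Q
  have hz0 : z ≠ 0 := by simpa using hzF 0
  obtain ⟨c, hc, hcz, -⟩ := hγ.exists_norm_ne_zero hz0
  rw [hz] at hcz
  obtain ⟨y, hy, hzm⟩ : ∃ y, y ≠ 0 ∧ z * m = m * z + y :=
    ⟨m * z + z * m, by rwa [Ne, CharTwo.add_eq_zero, eq_comm], by rw [CharTwo.add_cancel_left]⟩
  have hzy : Commute z y := by
    have hy' : y = m * z + z * m := by rw [hzm, CharTwo.add_cancel_left]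
    rw [commute_iff_eq, hy', mul_add, add_mul, ← mul_assoc z z, hcz, mul_assoc m, hcz, smul_one_mul,
      mul_smul_comm, mul_one, add_comm, mul_assoc]
  have hzi : z * (m * y⁻¹ * z) = m * y⁻¹ * z * z + z := by
    rw [← mul_assoc, ← mul_assoc, hzm, add_mul, add_mul, mul_inv_cancel₀ hy, one_mul, mul_assoc m,
      hzy.inv_right₀.eq]
    simp only [mul_assoc]
  obtain ⟨a, ha⟩ := hγ.exists_isArtinSchreier (hγ.map_eq_add_one hz0 hzi)
  exact ⟨a, Units.mk0 c hc, _, ha.mul_self, hzi, hcz⟩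

theorem exists_map_eq_and_mul_eq_mul_add {z : Q} (hγ : γ.IsCanonical) (hz : γ z = z)
    (hzF : ∀ r : F, z ≠ r • 1) (l : F) : ∃ e, γ e = e ∧ z * e = e * z + l • 1 := by
  have := charP_two_of_algebra F Q
  obtain ⟨a, c, i, P⟩ := exists_isSymbolPair_of_map_eq hγ hz hzF
  refine ⟨(l * (c : F)⁻¹) • (i * z), ?_, ?_⟩
  · rw [map_smul, γ.map_mul', hz, (P.isArtinSchreier hγ).map_eq, mul_add, mul_one, P.ji,
      CharTwo.add_cancel_right]
  · have hcl : (l * (c : F)⁻¹) * c = l := inv_mul_cancel_right₀ c.ne_zero l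
    rw [mul_smul_comm, P.ji_mul, P.jj, smul_add, smul_smul _ _ (1 : Q), hcl, smul_mul_assoc,
      mul_assoc, P.jj]

end Central

end SymbolPair

section Kaplansky

open scoped Quaternion

variable {F : Type u} [Field F]

section QuaternionAlgebra

variable [CharP F 2]

theorem eq_zero_of_artinSchreierNorm_eq_zero {a c x y : F} (ha : a ∉ symbolKer c)
    (h : artinSchreierNorm a x y = 0) : x = 0 ∧ y = 0 := by
  have hy : y = 0 := by
    by_contra hy
    refine ha ⟨0, x / y, ?_⟩
    rw [artinSchreierNorm] at h
    grind
  subst hy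
  simpa [artinSchreierNorm] using h

theorem mul_star_eq_smul_one {a c : F} (x : ℍ[F,a,1,c]) :
    x * star x = (artinSchreierNorm a x.re x.imI + c * artinSchreierNorm a x.imJ x.imK) • 1 := by
  obtain ⟨p, q, r, s⟩ := x
  ext <;> simp [artinSchreierNorm] <;> grind

theorem isUnit_or_eq_zero_of_notMem_symbolKer {a c : F} (hc : c ≠ 0) (ha : a ∉ symbolKer c)
    (x : ℍ[F,a,1,c]) : IsUnit x ∨ x = 0 := by
  have hx := mul_star_eq_smul_one x
  set n := artinSchreierNorm a x.re x.imI + c * artinSchreierNorm a x.imJ x.imK with hn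
  by_cases hn0 : n = 0
  · right
    rw [hn, CharTwo.add_eq_zero] at hn0
    have hJK : artinSchreierNorm a x.imJ x.imK = 0 := by
      by_contra hJK
      have hmul := mem_symbolKer_mul (mul_ne_zero hc hJK) hJK
        ((mem_symbolKer_iff_exists_norm (mul_ne_zero hc hJK)).2 ⟨_, _, hn0.symm⟩)
        ((mem_symbolKer_iff_exists_norm hJK).2 ⟨_, _, rfl⟩)
      rw [mul_assoc, ← sq, symbolKer_mul_sq c hJK] at hmul
      exact ha hmul
    obtain ⟨hJ, hK⟩ := eq_zero_of_artinSchreierNorm_eq_zero ha hJK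
    obtain ⟨hR, hI⟩ := eq_zero_of_artinSchreierNorm_eq_zero ha (hn0.trans (by rw [hJK, mul_zero]))
    exact QuaternionAlgebra.ext hR hI hJ hK
  · left
    refine isUnit_iff_exists.2 ⟨n⁻¹ • star x, ?_, ?_⟩
    · rw [mul_smul_comm, hx, inv_smul_smul₀ hn0]
    · rw [smul_mul_assoc, star_comm_self', hx, inv_smul_smul₀ hn0]

theorem isCentral_quaternionAlgebra (a : F) {c : F} (hc : c ≠ 0) :
    Algebra.IsCentral F ℍ[F,a,1,c] := by
  refine ⟨fun x hx => ?_⟩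
  rw [Subalgebra.mem_center_iff] at hx
  obtain ⟨p, q, r, s⟩ := x
  have hi := hx ⟨0, 1, 0, 0⟩
  have hj := hx ⟨0, 0, 1, 0⟩
  simp only [QuaternionAlgebra.mk_mul_mk, zero_mul, mul_one, zero_add, mul_zero, add_zero, one_mul,
    sub_zero, zero_sub, QuaternionAlgebra.mk.injEq, true_and, sub_self, add_eq_left, mul_eq_zero]
    at hi hj
  refine Algebra.mem_bot.2 ⟨p, ?_⟩
  rw [QuaternionAlgebra.algebraMap_eq]
  grind

end QuaternionAlgebra

theorem IsQuaternionAlgebra.of_algEquiv {A : Type v} {B : Type w} [DivisionRing A] [DivisionRing B]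
    [Algebra F A] [Algebra F B] (hA : IsQuaternionAlgebra F A) (e : A ≃ₐ[F] B) :
    IsQuaternionAlgebra F B where
  central := by
    have := hA.central
    refine ⟨fun x hx => ?_⟩
    have hx' : e.symm x ∈ Subalgebra.center F A := MulEquivClass.apply_mem_center e.symm hx
    rw [Algebra.IsCentral.center_eq_bot, Algebra.mem_bot] at hx'
    obtain ⟨r, hr⟩ := hx'
    exact Algebra.mem_bot.2 ⟨r, by rw [← e.apply_symm_apply x, ← hr, e.commutes]⟩
  simple := inferInstance
  finrank_eq := by rw [← hA.finrank_eq, e.toLinearEquiv.finrank_eq]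

theorem IsKaplanskyField.nonempty_algEquiv (hF : IsKaplanskyField F) {A : Type u} {Q : Type v}
    [DivisionRing A] [Algebra F A] [DivisionRing Q] [Algebra F Q] (hA : IsQuaternionAlgebra F A)
    (hQ : IsQuaternionAlgebra F Q) : Nonempty (A ≃ₐ[F] Q) := by
  have : Module.Finite F Q := Module.finite_of_finrank_eq_succ hQ.finrank_eq
  have : Small.{u} Q := ⟨_, ⟨(Module.finBasis F Q).equivFun.toEquiv⟩⟩
  obtain ⟨Q₀, _, _, -, h⟩ := hF
  obtain ⟨e₁⟩ := h A hA
  let e : Shrink.{u} Q ≃ₐ[F] Q := Shrink.algEquiv F Q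
  obtain ⟨e₂⟩ := h (Shrink.{u} Q) (hQ.of_algEquiv e.symm)
  exact ⟨(e₁.trans e₂.symm).trans e⟩

variable [CharP F 2]

variable (F) in
/-- Every quaternion division algebra `[a, c)` over `F` embeds in `Q`. -/
def RealizesSymbols (Q : Type v) [DivisionRing Q] [Algebra F Q] : Prop :=
  ∀ (a : F) (c : Fˣ), a ∉ symbolKer (c : F) → ∃ i j : Q, IsSymbolPair a c i j

variable {Q : Type v} [DivisionRing Q] [Algebra F Q]

theorem IsKaplanskyField.realizesSymbols (hF : IsKaplanskyField F) (hQ : IsQuaternionAlgebra F Q) :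
    RealizesSymbols F Q := by
  intro a c hac
  let _ : DivisionRing ℍ[F,a,1,(c : F)] :=
    .ofIsUnitOrEqZero (isUnit_or_eq_zero_of_notMem_symbolKer c.ne_zero hac)
  have hA : IsQuaternionAlgebra F ℍ[F,a,1,(c : F)] :=
    ⟨isCentral_quaternionAlgebra a c.ne_zero, inferInstance,
      QuaternionAlgebra.finrank_eq_four _ _ _⟩
  obtain ⟨e⟩ := hF.nonempty_algEquiv hA hQ
  refine ⟨e ⟨0, 1, 0, 0⟩, e ⟨0, 0, 1, 0⟩, ?_, ?_, ?_⟩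
  · rw [← map_mul, ← map_one e, ← map_smul, ← map_add]
    congr 1
    ext <;> simp
  · rw [← map_mul, ← map_mul, ← map_add]
    congr 1
    ext <;> simp
    grind
  · rw [← map_mul, ← map_one e, ← map_smul]
    congr 1
    ext <;> simp

namespace RealizesSymbols

variable {γ : FInvolution F Q}

theorem add_mem_symbolKer (hQ : RealizesSymbols F Q) (hγ : γ.IsCanonical) {a b : F} {c : Fˣ}
    (ha : a ∉ symbolKer (c : F)) (hb : b ∉ symbolKer (c : F)) : a + b ∈ symbolKer (c : F) := by
  obtain ⟨i, j, P⟩ := hQ a c ha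
  obtain ⟨i', j', P'⟩ := hQ b c hb
  obtain ⟨k, P'⟩ := P.exists_conj_right P'
  obtain ⟨x, y, rfl⟩ := P.exists_eq_add P' hγ
  refine ⟨y, x, smul_one_injective (Q := Q) ?_⟩
  have h := P'.ii
  simp only [add_mul, mul_add, P.ii, P.ji, P.jj, smul_mul_assoc, mul_smul_comm, one_mul, mul_one]
    at h
  linear_combination (norm := skip) h
  match_scalars <;> grind

theorem mem_symbolKer_mul (hQ : RealizesSymbols F Q) (hγ : γ.IsCanonical) {a : F} {c d : Fˣ}
    (hc : a ∉ symbolKer (c : F)) (hd : a ∉ symbolKer (d : F)) :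
    a ∈ symbolKer ((c * d : Fˣ) : F) := by
  obtain ⟨i, j, P⟩ := hQ a c hc
  obtain ⟨i', j', P'⟩ := hQ a d hd
  obtain ⟨k, P'⟩ := P.exists_conj_left P'
  obtain ⟨x, y, rfl⟩ := P.exists_eq_smul_add_mul P' hγ
  have hd : (d : F) = c * artinSchreierNorm a x y := by
    have h := P'.jj
    simp only [add_mul, mul_add, P.ii, P.jj, P.ji_mul, smul_mul_assoc, mul_smul_comm, one_mul,
      mul_one, mul_assoc] at h
    refine smul_one_injective (Q := Q) ?_
    simp only [artinSchreierNorm]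
    linear_combination (norm := skip) -h
    match_scalars <;> grind
  rw [mem_symbolKer_iff_exists_norm (c * d).ne_zero, Units.val_mul, hd]
  exact ⟨c * x, c * y, by simp only [artinSchreierNorm]; ring⟩

theorem isTwoValuedSymbol (hQ : RealizesSymbols F Q) (hγ : γ.IsCanonical) :
    IsTwoValuedSymbol F where
  add_mem_iff a b c := by
    by_cases ha : a ∈ symbolKer (c : F)
    · simp only [add_mem_cancel_left ha, ha, true_iff]
    by_cases hb : b ∈ symbolKer (c : F)
    · simp only [add_mem_cancel_right hb, ha, hb, iff_true]
    · simp only [hQ.add_mem_symbolKer hγ ha hb, ha, hb]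
  mul_mem_iff a c d := by
    have cancel : ∀ {c d : Fˣ}, a ∈ symbolKer (c : F) → a ∈ symbolKer ((c * d : Fˣ) : F) →
        a ∈ symbolKer (d : F) := fun {c d} hc hcd => by
      have := _root_.mem_symbolKer_mul c.ne_zero (c * d).ne_zero hc hcd
      rwa [Units.val_mul, ← mul_assoc, mul_comm, ← sq, symbolKer_mul_sq _ c.ne_zero] at this
    by_cases hc : a ∈ symbolKer (c : F) <;> by_cases hd : a ∈ symbolKer (d : F)
    · simp only [hc, hd, Units.val_mul, _root_.mem_symbolKer_mul c.ne_zero d.ne_zero]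
    · exact iff_of_false (fun h => hd (cancel hc h)) (by tauto)
    · exact iff_of_false (fun h => hc (cancel hd (mul_comm c d ▸ h))) (by tauto)
    · simp only [hc, hd, hQ.mem_symbolKer_mul hγ hc hd]

theorem exists_isArtinSchreier (hQ : RealizesSymbols F Q) (hγ : γ.IsCanonical) {a : F}
    (ha : a ∉ symbolRadical F) : ∃ u, IsArtinSchreier γ u a := by
  obtain ⟨c, hc⟩ := notMem_symbolRadical.1 ha
  obtain ⟨i, j, P⟩ := hQ a c hc
  exact ⟨i, P.isArtinSchreier hγ⟩

end RealizesSymbols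

end Kaplansky

section ArtinSchreier

variable {F : Type u} [Field F] [CharP F 2] {Q : Type v} [DivisionRing Q] [Algebra F Q]
  {γ : FInvolution F Q}

theorem FInvolution.IsCanonical.exists_eq_smul_of_map_ne (hγ : γ.IsCanonical) {a : Q}
    (ha : γ a ≠ a) : ∃ (t : F) (u : Q) (δ : F), t ≠ 0 ∧ IsArtinSchreier γ u δ ∧ a = t • u := by
  obtain ⟨t, ht⟩ := hγ.exists_map_eq_add a
  have ht0 : t ≠ 0 := by
    rintro rfl
    simp [ht] at ha
  obtain ⟨δ, hδ⟩ := hγ.exists_isArtinSchreier (u := t⁻¹ • a)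
    (by rw [map_smul, ht, smul_add, inv_smul_smul₀ ht0])
  exact ⟨t, _, δ, ht0, hδ, (smul_inv_smul₀ ht0 a).symm⟩

theorem IsSymbolPair.isArtinSchreier_add_mul {a : F} {c : Fˣ} {i j : Q} (P : IsSymbolPair a c i j)
    (hγ : γ.IsCanonical) (x y : F) :
    IsArtinSchreier γ (i + (x • 1 + y • i) * j) (a + c * artinSchreierNorm a x y) where
  map_eq := by
    simp only [map_add, map_smul, γ.map_mul', (P.isArtinSchreier hγ).map_eq,
      P.map_right hγ, mul_add, add_mul, P.ji, smul_mul_assoc, one_mul, mul_one]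
    match_scalars <;> grind
  mul_self := by
    simp only [artinSchreierNorm, add_mul, mul_add, P.ii, P.ji, P.jj, P.ii_mul, P.ji_mul,
      smul_mul_assoc, mul_smul_comm, one_mul, mul_one, mul_assoc]
    match_scalars <;> grind

namespace IsArtinSchreier

variable {u₁ u₂ u₃ : Q} {δ₁ δ₂ δ₃ : F}

theorem sum_coeff_eq_zero {s₁ s₂ s₃ f : F} (h₁ : IsArtinSchreier γ u₁ δ₁)
    (h₂ : IsArtinSchreier γ u₂ δ₂) (h₃ : IsArtinSchreier γ u₃ δ₃)
    (h : s₁ • u₁ + s₂ • u₂ + s₃ • u₃ = f • 1) : s₁ + s₂ + s₃ = 0 := by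
  have hmap := congrArg γ.toLinearMap h
  simp only [map_add, map_smul, h₁.map_eq, h₂.map_eq, h₃.map_eq, γ.map_one] at hmap
  refine smul_one_injective (Q := Q) ?_
  linear_combination (norm := skip) hmap - h
  match_scalars <;> grind

theorem add_add {s₁ s₂ s₃ f : F} (h₁ : IsArtinSchreier γ u₁ δ₁)
    (h₂ : IsArtinSchreier γ u₂ δ₂) (h₃ : IsArtinSchreier γ u₃ δ₃) (hs₃ : s₃ ≠ 0)
    (h : s₁ • u₁ + s₂ • u₂ + s₃ • u₃ = f • 1) :
    IsArtinSchreier γ (u₁ + u₂ + u₃) (δ₁ + δ₂ + δ₃) where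
  map_eq := by
    have := charP_two_of_algebra F Q
    simp only [map_add, h₁.map_eq, h₂.map_eq, h₃.map_eq]
    grind
  mul_self := by
    have hs := h₁.sum_coeff_eq_zero h₂ h₃ h
    have h12 : s₂ • (u₁ * u₂ + u₂ * u₁) + s₃ • (u₁ * u₃ + u₃ * u₁) = 0 := by
      have hl := congrArg (u₁ * ·) h
      have hr := congrArg (· * u₁) h
      simp only [mul_add, add_mul, mul_smul_comm, smul_mul_assoc, mul_one, one_mul] at hl hr
      linear_combination (norm := skip) hl - hr
      match_scalars <;> grind
    have h21 : s₁ • (u₁ * u₂ + u₂ * u₁) + s₃ • (u₂ * u₃ + u₃ * u₂) = 0 := by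
      have hl := congrArg (u₂ * ·) h
      have hr := congrArg (· * u₂) h
      simp only [mul_add, add_mul, mul_smul_comm, smul_mul_assoc, mul_one, one_mul] at hl hr
      linear_combination (norm := skip) hl - hr
      match_scalars <;> grind
    have hcross : u₁ * u₂ + u₂ * u₁ + (u₁ * u₃ + u₃ * u₁) + (u₂ * u₃ + u₃ * u₂) = 0 := by
      refine smul_right_injective Q hs₃ ?_
      linear_combination (norm := skip) h12 + h21 + hs • (u₁ * u₂ + u₂ * u₁)
      match_scalars <;> grind
    simp only [mul_add, add_mul, h₁.mul_self, h₂.mul_self, h₃.mul_self]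
    linear_combination (norm := skip) hcross
    match_scalars <;> grind

end IsArtinSchreier

end ArtinSchreier

section Radical

variable {F : Type u} [Field F] [CharP F 2] {Q : Type v} [DivisionRing Q] [Algebra F Q]
  [Algebra.IsCentral F Q] {γ : FInvolution F Q}

theorem IsArtinSchreier.notMem_symbolRadical {u : Q} {δ : F} (h : IsArtinSchreier γ u δ)
    (hγ : γ.IsCanonical) : δ ∉ symbolRadical F := by
  obtain ⟨c, j, P⟩ := h.exists_isSymbolPair hγ
  exact _root_.notMem_symbolRadical.2 ⟨c, P.notMem_symbolKer hγ⟩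

theorem FInvolution.IsCanonical.exists_isSymbolPair (hγ : γ.IsCanonical)
    (hdim : Module.finrank F Q ≠ 1) : ∃ (a : F) (c : Fˣ) (i j : Q), IsSymbolPair a c i j := by
  obtain ⟨x, hx⟩ : ∃ x : Q, γ x ≠ x := by
    by_contra! hid
    have hcentre : (⊤ : Subalgebra F Q) = ⊥ := by
      rw [← Algebra.IsCentral.center_eq_bot F Q, eq_comm, eq_top_iff]
      intro x _
      rw [Subalgebra.mem_center_iff]
      intro y
      rw [← hid (y * x), γ.map_mul', hid, hid]
    exact hdim (Subalgebra.bot_eq_top_iff_finrank_eq_one.1 hcentre.symm)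
  obtain ⟨-, u, δ, -, hu, -⟩ := hγ.exists_eq_smul_of_map_ne hx
  obtain ⟨c, j, P⟩ := hu.exists_isSymbolPair hγ
  exact ⟨δ, c, u, j, P⟩

theorem exists_notMem_symbolRadical_add (hγ : γ.IsCanonical)
    (hdim : Module.finrank F Q ≠ 1) (d : F) :
    ∃ b, b ∉ symbolRadical F ∧ d + b ∉ symbolRadical F := by
  by_contra! hcon
  obtain ⟨a, c, i, j, P⟩ := hγ.exists_isSymbolPair hdim
  have norm_mem : ∀ x y : F, (c : F) * artinSchreierNorm a x y ∈ symbolRadical F := by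
    intro x y
    have hda := hcon a ((P.isArtinSchreier hγ).notMem_symbolRadical hγ)
    have hdn := hcon _ ((P.isArtinSchreier_add_mul hγ x y).notMem_symbolRadical hγ)
    rwa [← add_assoc, add_mem_cancel_left hda] at hdn
  have all_mem : ∀ z : F, z ∈ symbolRadical F := by
    intro z
    have h := add_mem (add_mem (norm_mem 1 (z / c)) (norm_mem 0 (z / c))) (norm_mem 1 0)
    simp only [artinSchreierNorm] at h
    have hc := c.ne_zero
    convert h using 1
    grind
  exact (P.isArtinSchreier hγ).notMem_symbolRadical hγ (all_mem a)

theorem exists_notMem_symbolRadical_add_add (hγ : γ.IsCanonical)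
    (hdim : Module.finrank F Q ≠ 1) (d e : F) :
    ∃ b, b ∉ symbolRadical F ∧ d + b ∉ symbolRadical F ∧ e + b ∉ symbolRadical F := by
  by_cases hd : d ∈ symbolRadical F
  · obtain ⟨b, hb, heb⟩ := exists_notMem_symbolRadical_add hγ hdim e
    exact ⟨b, hb, by rwa [add_mem_cancel_left hd], heb⟩
  by_cases he : e ∈ symbolRadical F
  · obtain ⟨b, hb, hdb⟩ := exists_notMem_symbolRadical_add hγ hdim d
    exact ⟨b, hb, hdb, by rwa [add_mem_cancel_left he]⟩
  by_cases hde : d + e ∈ symbolRadical F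
  · obtain ⟨b, hb, hdb⟩ := exists_notMem_symbolRadical_add hγ hdim d
    refine ⟨b, hb, hdb, fun heb => hdb ?_⟩
    simpa only [add_assoc, CharTwo.add_cancel_left] using add_mem hde heb
  · refine ⟨d + e, hde, ?_, ?_⟩
    · rwa [CharTwo.add_cancel_left]
    · rwa [add_comm, CharTwo.add_cancel_right]

end Radical

section HermitianForms

variable {F : Type u} [Field F] {D : Type v} [DivisionRing D] [Algebra F D]
  {θ : FInvolution F D} {V : Type w} [AddCommGroup V] [Module Dᵐᵒᵖ V]

theorem finrank_mulOpposite_self (D : Type*) [DivisionRing D] : Module.finrank Dᵐᵒᵖ D = 1 :=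
  finrank_eq_one (1 : D) one_ne_zero fun w => ⟨MulOpposite.op w, one_mul w⟩

instance finite_mulOpposite_self (D : Type*) [DivisionRing D] : Module.Finite Dᵐᵒᵖ D :=
  Module.finite_of_finrank_eq_succ (finrank_mulOpposite_self D)

theorem finrank_mulOpposite_pi (D ι : Type*) [DivisionRing D] [Fintype ι] :
    Module.finrank Dᵐᵒᵖ (ι → D) = Fintype.card ι := by
  simp only [Module.finrank_pi_fintype, finrank_mulOpposite_self, Finset.sum_const,
    Finset.card_univ, smul_eq_mul, mul_one]

/-- The linear map `d ↦ ∑ i, vᵢ dᵢ` from the standard right `D`-vector space attached to a family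
`v`. -/
def rightCombination {ι : Type*} [Fintype ι] (v : ι → V) : (ι → D) →ₗ[Dᵐᵒᵖ] V where
  toFun d := ∑ i, v i <• d i
  map_add' x y := by
    simp only [Pi.add_apply, MulOpposite.op_add, add_smul, Finset.sum_add_distrib]
  map_smul' c x := by
    simp only [Finset.smul_sum, smul_smul]
    rfl

theorem rightCombination_apply {ι : Type*} [Fintype ι] (v : ι → V) (d : ι → D) :
    rightCombination v d = ∑ i, v i <• d i := rfl

namespace HermForm

theorem smul_right (h : HermForm θ V) (x y : V) (d : D) : h x (y <• d) = h x y * d := by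
  simpa [θ.map_one] using h.smul' x y 1 d

/-- The linear form `h(x, ·)`. -/
def rightLinear (h : HermForm θ V) (x : V) : V →ₗ[Dᵐᵒᵖ] D where
  toFun := h x
  map_add' := h.add_right' x
  map_smul' c y := h.smul_right x y c.unop

theorem map_sum_right (h : HermForm θ V) (x : V) {ι : Type*} (s : Finset ι) (f : ι → V) :
    h x (∑ i ∈ s, f i) = ∑ i ∈ s, h x (f i) := map_sum (h.rightLinear x) f s

theorem eq_zero_comm (h : HermForm θ V) {x y : V} (hxy : h x y = 0) : h y x = 0 := by
  rw [h.symm', hxy, map_zero]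

theorem eq_zero_of_alternating (h : HermForm θ V) (hθ : ∃ b : D, b + θ b ≠ 0)
    (U : Submodule Dᵐᵒᵖ V) (hU : ∀ x ∈ U, h x x = 0) {x y : V} (hx : x ∈ U) (hy : y ∈ U) :
    h x y = 0 := by
  by_contra hxy
  obtain ⟨b, hb⟩ := hθ
  have hy' : y <• ((h x y)⁻¹ * b) ∈ U := U.smul_mem _ hy
  have hadd := hU _ (U.add_mem hx hy')
  rw [h.add_left', h.add_right', h.add_right', hU _ hx, hU _ hy', zero_add, add_zero,
    h.symm' x (y <• _), h.smul_right, mul_inv_cancel_left₀ hxy] at hadd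
  exact hb hadd

/-- A family of pairwise orthogonal non-isotropic vectors. -/
structure IsOrthogonalFamily {ι : Type*} (h : HermForm θ V) (v : ι → V) : Prop where
  self_ne_zero : ∀ i, h (v i) (v i) ≠ 0
  pairwise : Pairwise fun i j => h (v i) (v j) = 0

namespace IsOrthogonalFamily

variable {h : HermForm θ V}

section Fintype

variable {ι : Type*} [Fintype ι] {v : ι → V}

theorem apply_rightCombination (hv : h.IsOrthogonalFamily v) (i : ι) (d : ι → D) :
    h (v i) (rightCombination v d) = h (v i) (v i) * d i := by
  rw [rightCombination_apply, h.map_sum_right, Finset.sum_eq_single i, h.smul_right]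
  · intro j _ hj
    rw [h.smul_right, hv.pairwise hj.symm, zero_mul]
  · simp

theorem rightCombination_injective (hv : h.IsOrthogonalFamily v) :
    Function.Injective (rightCombination (D := D) v) := by
  intro d e hde
  funext i
  have hi := congrArg (h (v i)) hde
  rw [hv.apply_rightCombination, hv.apply_rightCombination] at hi
  exact mul_left_cancel₀ (hv.self_ne_zero i) hi

theorem exists_eq_rightCombination_add (hv : h.IsOrthogonalFamily v) (x : V) :
    ∃ (d : ι → D) (y : V), x = rightCombination v d + y ∧ ∀ i, h (v i) y = 0 := by
  set d : ι → D := fun i => (h (v i) (v i))⁻¹ * h (v i) x with hd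
  refine ⟨d, x - rightCombination v d, (add_sub_cancel _ _).symm, fun i => ?_⟩
  have hi := h.add_right' (v i) (rightCombination v d) (x - rightCombination v d)
  rwa [add_sub_cancel, hv.apply_rightCombination, hd, mul_inv_cancel_left₀ (hv.self_ne_zero i),
    left_eq_add] at hi

theorem exists_orthogonal (hv : h.IsOrthogonalFamily v) (hnd : h.Nondegenerate)
    (hθ : ∃ b : D, b + θ b ≠ 0) (hcard : Fintype.card ι < Module.finrank Dᵐᵒᵖ V) :
    ∃ u, h u u ≠ 0 ∧ ∀ i, h (v i) u = 0 := by
  by_contra! hcon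
  let U : Submodule Dᵐᵒᵖ V := ⨅ i, LinearMap.ker (h.rightLinear (v i))
  have mem_U : ∀ y, y ∈ U ↔ ∀ i, h (v i) y = 0 := fun y => by
    simp only [U, Submodule.mem_iInf, LinearMap.mem_ker]
    rfl
  have alternating : ∀ y ∈ U, h y y = 0 := fun y hy => by
    by_contra hyy
    obtain ⟨i, hi⟩ := hcon y hyy
    exact hi ((mem_U y).1 hy i)
  have surjective : Function.Surjective (rightCombination (D := D) v) := by
    intro x
    obtain ⟨d, y, rfl, hy⟩ := hv.exists_eq_rightCombination_add x
    refine ⟨d, ?_⟩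
    rw [left_eq_add]
    refine hnd y fun z => ?_
    obtain ⟨e, z, rfl, hz⟩ := hv.exists_eq_rightCombination_add z
    rw [h.add_right', h.eq_zero_of_alternating hθ U alternating ((mem_U y).2 hy) ((mem_U z).2 hz),
      add_zero, rightCombination_apply, h.map_sum_right]
    refine Finset.sum_eq_zero fun i _ => ?_
    rw [h.smul_right, h.eq_zero_comm (hy i), zero_mul]
  have hle := (rightCombination (D := D) v).finrank_le_finrank_of_surjective surjective
  rw [finrank_mulOpposite_pi] at hle
  omega

end Fintype

theorem cons {k : ℕ} {v : Fin k → V} (hv : h.IsOrthogonalFamily v) {u : V} (hu : h u u ≠ 0)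
    (huv : ∀ i, h (v i) u = 0) :
    h.IsOrthogonalFamily (Fin.cons u v : Fin (k + 1) → V) where
  self_ne_zero := Fin.cases hu hv.self_ne_zero
  pairwise := by
    intro i j hij
    cases i using Fin.cases with
    | zero =>
      cases j using Fin.cases with
      | zero => exact absurd rfl hij
      | succ j => exact h.eq_zero_comm (huv j)
    | succ i =>
      cases j using Fin.cases with
      | zero => exact huv i
      | succ j => exact hv.pairwise fun e => hij (congrArg Fin.succ e)

end IsOrthogonalFamily

theorem Nondegenerate.exists_isOrthogonalFamily {h : HermForm θ V} (hnd : h.Nondegenerate)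
    (hθ : ∃ b : D, b + θ b ≠ 0) {k : ℕ} (hk : k ≤ Module.finrank Dᵐᵒᵖ V) :
    ∃ v : Fin k → V, h.IsOrthogonalFamily v := by
  induction k with
  | zero => exact ⟨Fin.elim0, ⟨fun i => i.elim0, fun i => i.elim0⟩⟩
  | succ k ih =>
    obtain ⟨v, hv⟩ := ih (Nat.le_of_succ_le hk)
    obtain ⟨u, hu, huv⟩ := hv.exists_orthogonal hnd hθ (by rwa [Fintype.card_fin])
    exact ⟨_, hv.cons hu huv⟩

/-- The hermitian form `h(x, y) = ∑ i, θ(xᵢ) bᵢ yᵢ` with `θ`-symmetric coefficients. -/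
def diagonal {ι : Type*} [Fintype ι] (θ : FInvolution F D) (b : ι → D) (hb : ∀ i, θ (b i) = b i) :
    HermForm θ (ι → D) where
  toFun x y := ∑ i, θ (x i) * b i * y i
  add_left' x y z := by simp only [Pi.add_apply, map_add, add_mul, Finset.sum_add_distrib]
  add_right' x y z := by simp only [Pi.add_apply, mul_add, Finset.sum_add_distrib]
  smul' x y c d := by
    simp only [Finset.sum_mul, Finset.mul_sum, Pi.smul_apply, MulOpposite.smul_eq_mul_unop,
      MulOpposite.unop_op, θ.map_mul', mul_assoc]
  symm' x y := by simp only [map_sum, θ.map_mul', θ.invol', hb, mul_assoc]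

end HermForm

end HermitianForms

section QuadraticForms

variable {F : Type u} [Field F] {D : Type v} [DivisionRing D] [Algebra F D]

namespace FInvolution

variable (θ : FInvolution F D)

theorem mem_alt {a : D} : a ∈ θ.alt ↔ ∃ b, b - θ b = a := by
  simp [FInvolution.alt, LinearMap.mem_range]

theorem conj_mkQ (d a : D) : θ.conj d (θ.alt.mkQ a) = θ.alt.mkQ (θ d * (a * d)) := rfl

theorem mkQ_eq_zero {a : D} : θ.alt.mkQ a = 0 ↔ a ∈ θ.alt := by
  rw [← LinearMap.mem_ker, Submodule.ker_mkQ]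

theorem alt_ne_top : θ.alt ≠ ⊤ := by
  intro htop
  have map_eq_neg : ∀ a, θ a = -a := fun a => by
    obtain ⟨b, rfl⟩ := θ.mem_alt.1 (htop ▸ Submodule.mem_top : a ∈ θ.alt)
    rw [map_sub, θ.invol', neg_sub]
  obtain ⟨b, hb⟩ := θ.mem_alt.1 (htop ▸ Submodule.mem_top : (1 : D) ∈ θ.alt)
  have two_eq_zero : (1 : D) + 1 = 0 := by
    have h := map_eq_neg 1
    rw [θ.map_one] at h
    exact eq_neg_iff_add_eq_zero.1 h
  refine one_ne_zero (α := D) ?_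
  rw [← hb, map_eq_neg, sub_neg_eq_add, ← mul_one b, ← mul_add, two_eq_zero, mul_zero]

end FInvolution

variable {θ : FInvolution F D} {V : Type w} [AddCommGroup V] [Module Dᵐᵒᵖ V]

namespace QuadForm

section Polar

variable (q : QuadForm θ V)

theorem map_zero : q 0 = 0 := by
  obtain ⟨a, ha⟩ := θ.alt.mkQ_surjective (q 0)
  have h := q.smul' 0 0
  rwa [smul_zero, ← ha, θ.conj_mkQ, mul_zero, mul_zero, _root_.map_zero, ha] at h

theorem map_add_of_polar_eq_zero {x y : V} (h : q.polar x y = 0) : q (x + y) = q x + q y := by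
  have hspec := q.polar_spec x y
  rwa [h, _root_.map_zero, sub_sub, sub_eq_zero] at hspec

theorem map_sum_of_orthogonal {ι : Type*} (s : Finset ι) {v : ι → V}
    (hv : Pairwise fun i j => q.polar (v i) (v j) = 0) (d : ι → D) :
    q (∑ i ∈ s, v i <• d i) = ∑ i ∈ s, θ.conj (d i) (q (v i)) := by
  induction s using Finset.cons_induction with
  | empty => exact q.map_zero
  | cons i s hi ih =>
    rw [Finset.sum_cons, Finset.sum_cons, q.map_add_of_polar_eq_zero, ih, q.smul']
    rw [q.polar.map_sum_right]
    refine Finset.sum_eq_zero fun j hj => ?_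
    rw [q.polar.smul', hv (ne_of_mem_of_not_mem hj hi).symm, mul_zero, zero_mul]

theorem polar_self {x : V} {a : D} (ha : q x = θ.alt.mkQ a) : q.polar x x = a + θ a := by
  -- Evaluating `q` at `x + xd = x(1 + d)` shows that the difference times any `d` is in `Alt`.
  have mul_mem_alt : ∀ d, (q.polar x x - (a + θ a)) * d ∈ θ.alt := fun d => by
    have h := q.polar_spec x (x <• d)
    have hx : x + x <• d = x <• (1 + d) := by
      rw [MulOpposite.op_add, add_smul, MulOpposite.op_one, one_smul]
    rw [hx, q.smul', q.smul', ha, θ.conj_mkQ, θ.conj_mkQ, ← map_sub, ← map_sub, q.polar.smul_right,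
      ← sub_eq_zero, ← map_sub, θ.mkQ_eq_zero, θ.mem_alt] at h
    obtain ⟨b, hb⟩ := h
    refine θ.mem_alt.2 ⟨θ d * a - b, ?_⟩
    rw [map_sub, sub_sub_sub_comm, hb, θ.map_mul', θ.invol', map_add, θ.map_one]
    noncomm_ring
  by_contra hne
  refine θ.alt_ne_top (eq_top_iff.2 fun y _ => ?_)
  simpa only [mul_inv_cancel_left₀ (sub_ne_zero.2 hne)] using
    mul_mem_alt ((q.polar x x - (a + θ a))⁻¹ * y)

end Polar

section Diagonal

variable {ι : Type*} [Fintype ι] (θ) (a : ι → D)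

theorem diagonal_add_sub_sub (x y : ι → D) :
    θ.alt.mkQ (∑ i, θ ((x + y) i) * (a i * (x + y) i)) - θ.alt.mkQ (∑ i, θ (x i) * (a i * x i)) -
      θ.alt.mkQ (∑ i, θ (y i) * (a i * y i)) =
    θ.alt.mkQ (∑ i, θ (x i) * (a i + θ (a i)) * y i) := by
  rw [← map_sub, ← map_sub, ← sub_eq_zero, ← map_sub, θ.mkQ_eq_zero]
  simp only [← Finset.sum_sub_distrib]
  refine Submodule.sum_mem _ fun i _ => θ.mem_alt.2 ⟨θ (y i) * (a i * x i), ?_⟩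
  simp only [Pi.add_apply, map_add, θ.map_mul', θ.invol']
  noncomm_ring

/-- The diagonal quadratic form with value `∑ i, θ(xᵢ) aᵢ xᵢ + Alt` at `x`. -/
def diagonal : QuadForm θ (ι → D) where
  toFun x := θ.alt.mkQ (∑ i, θ (x i) * (a i * x i))
  smul' x d := by
    rw [θ.conj_mkQ]
    refine congrArg θ.alt.mkQ ?_
    simp only [Finset.sum_mul, Finset.mul_sum, Pi.smul_apply, MulOpposite.smul_eq_mul_unop,
      MulOpposite.unop_op, θ.map_mul', mul_assoc]
  exists_polar' :=
    ⟨HermForm.diagonal θ (fun i => a i + θ (a i)) fun i => by rw [map_add, θ.invol', add_comm],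
      diagonal_add_sub_sub θ a⟩

theorem diagonal_apply (x : ι → D) :
    diagonal θ a x = θ.alt.mkQ (∑ i, θ (x i) * (a i * x i)) := rfl

theorem diagonal_polar (x y : ι → D) :
    (diagonal θ a).polar x y = ∑ i, θ (x i) * (a i + θ (a i)) * y i :=
  ((diagonal θ a).polar_unique
    (HermForm.diagonal θ (fun i => a i + θ (a i)) fun i => by rw [map_add, θ.invol', add_comm])
    (diagonal_add_sub_sub θ a) x y).symm

theorem diagonal_append {m n : ℕ} (a x : Fin m → D) (b y : Fin n → D) :
    diagonal θ (Fin.append a b) (Fin.append x y) = diagonal θ a x + diagonal θ b y := by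
  simp only [diagonal_apply, Fin.sum_univ_add, Fin.append_left, Fin.append_right, map_add]

variable {θ a} in
theorem diagonal_nonsingular (ha : ∀ i, a i + θ (a i) ≠ 0) : (diagonal θ a).Nonsingular := by
  classical
  intro x hx
  funext i
  have hi := hx (Pi.single i 1)
  rw [diagonal_polar, Finset.sum_eq_single i (fun j _ hj => by
    rw [Pi.single_eq_of_ne hj, mul_zero]) (by simp), Pi.single_eq_same, mul_one] at hi
  by_contra hxi
  exact mul_ne_zero (θ.map_ne_zero hxi) (ha i) hi

end Diagonal

section Subform

/-- `q₁` embeds isometrically into `q₂`. -/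
def IsSubform {V₁ V₂ : Type*} [AddCommGroup V₁] [Module Dᵐᵒᵖ V₁] [AddCommGroup V₂]
    [Module Dᵐᵒᵖ V₂] (q₁ : QuadForm θ V₁) (q₂ : QuadForm θ V₂) : Prop :=
  ∃ f : V₁ →ₗ[Dᵐᵒᵖ] V₂, Function.Injective f ∧ ∀ x, q₁ x = q₂ (f x)

theorem Isometric.isSubform {V₁ V₂ : Type w} [AddCommGroup V₁] [Module Dᵐᵒᵖ V₁] [AddCommGroup V₂]
    [Module Dᵐᵒᵖ V₂] {q₁ : QuadForm θ V₁} {q₂ : QuadForm θ V₂} (h : q₁.Isometric q₂) :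
    q₂.IsSubform q₁ := by
  obtain ⟨e, he⟩ := h
  exact ⟨e.symm, e.symm.injective, fun x => by
    rw [he, LinearEquiv.coe_coe, LinearEquiv.apply_symm_apply]⟩

section

variable {V₁ V₂ V₃ : Type*} [AddCommGroup V₁] [Module Dᵐᵒᵖ V₁] [AddCommGroup V₂]
  [Module Dᵐᵒᵖ V₂] [AddCommGroup V₃] [Module Dᵐᵒᵖ V₃] {q₁ : QuadForm θ V₁} {q₂ : QuadForm θ V₂}
  {q₃ : QuadForm θ V₃}

theorem IsSubform.trans (h₁₂ : q₁.IsSubform q₂) (h₂₃ : q₂.IsSubform q₃) : q₁.IsSubform q₃ := by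
  obtain ⟨f, hf, hq⟩ := h₁₂
  obtain ⟨g, hg, hq'⟩ := h₂₃
  exact ⟨g ∘ₗ f, hg.comp hf, fun x => by rw [hq, hq', LinearMap.comp_apply]⟩

theorem IsSubform.isotropic (h : q₁.IsSubform q₂) (hq : q₁.Isotropic) : q₂.Isotropic := by
  obtain ⟨f, hf, hfq⟩ := h
  obtain ⟨x, hx0, hx⟩ := hq
  exact ⟨f x, (map_ne_zero_iff f hf).2 hx0, by rw [← hfq, hx]⟩

end

universe u₁ in
theorem IsSubform.orthSum {V₁ V₂ : Type u₁} [AddCommGroup V₁] [Module Dᵐᵒᵖ V₁] [AddCommGroup V₂]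
    [Module Dᵐᵒᵖ V₂] {W₁ W₂ : Type w} [AddCommGroup W₁] [Module Dᵐᵒᵖ W₁] [AddCommGroup W₂]
    [Module Dᵐᵒᵖ W₂] {q₁ : QuadForm θ V₁} {q₂ : QuadForm θ V₂} {r₁ : QuadForm θ W₁}
    {r₂ : QuadForm θ W₂} (h₁ : q₁.IsSubform r₁) (h₂ : q₂.IsSubform r₂) :
    (q₁.orthSum q₂).IsSubform (r₁.orthSum r₂) := by
  obtain ⟨f, hf, hfq⟩ := h₁
  obtain ⟨g, hg, hgq⟩ := h₂
  exact ⟨f.prodMap g, hf.prodMap hg, fun x => congrArg₂ (· + ·) (hfq x.1) (hgq x.2)⟩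

theorem isSubform_diagonal_append {m n : ℕ} (a : Fin m → D) (b : Fin n → D) :
    (diagonal θ (Fin.append a b)).IsSubform ((diagonal θ a).orthSum (diagonal θ b)) := by
  let f := (LinearMap.funLeft Dᵐᵒᵖ D (Fin.castAdd n)).prod (LinearMap.funLeft Dᵐᵒᵖ D (Fin.natAdd m))
  refine ⟨f, fun x y hxy => ?_, fun x => ?_⟩
  · funext i
    induction i using Fin.addCases with
    | left i => exact congrFun (congrArg Prod.fst hxy) i
    | right i => exact congrFun (congrArg Prod.snd hxy) i
  · conv_lhs => rw [← Fin.append_castAdd_natAdd (f := x), diagonal_append]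
    rfl

theorem isSubform_orthSum_left {V₁ V₂ : Type w} [AddCommGroup V₁] [Module Dᵐᵒᵖ V₁]
    [AddCommGroup V₂] [Module Dᵐᵒᵖ V₂] (q₁ : QuadForm θ V₁) (q₂ : QuadForm θ V₂) :
    q₁.IsSubform (q₁.orthSum q₂) :=
  ⟨LinearMap.inl _ _ _, LinearMap.inl_injective, fun x =>
    (add_zero (q₁ x)).symm.trans (congrArg (q₁ x + ·) q₂.map_zero.symm)⟩

variable {q : QuadForm θ V}

theorem isSubform_diagonal {ι : Type*} [Fintype ι] {a : ι → D} {v : ι → V}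
    (hinj : Function.Injective (rightCombination (D := D) v))
    (hv : Pairwise fun i j => q.polar (v i) (v j) = 0) (ha : ∀ i, q (v i) = θ.alt.mkQ (a i)) :
    (diagonal θ a).IsSubform q :=
  ⟨rightCombination v, hinj, fun x => by
    simp only [rightCombination_apply, q.map_sum_of_orthogonal _ hv, ha, θ.conj_mkQ, diagonal_apply,
      map_sum]⟩

theorem Nonsingular.exists_isSubform_diagonal (hq : q.Nonsingular) (hθ : ∃ b : D, b + θ b ≠ 0)
    {k : ℕ} (hk : k ≤ Module.finrank Dᵐᵒᵖ V) :
    ∃ a : Fin k → D, (∀ i, a i + θ (a i) ≠ 0) ∧ (diagonal θ a).IsSubform q := by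
  obtain ⟨v, hv⟩ := HermForm.Nondegenerate.exists_isOrthogonalFamily hq hθ hk
  choose a ha using fun i => θ.alt.mkQ_surjective (q (v i))
  refine ⟨a, fun i => ?_, isSubform_diagonal hv.rightCombination_injective hv.pairwise
    fun i => (ha i).symm⟩
  rw [← q.polar_self (ha i).symm]
  exact hv.self_ne_zero i

theorem TotallySingular.exists_isSubform_diagonal [Module.Finite Dᵐᵒᵖ V] (hq : q.TotallySingular)
    {k : ℕ} (hk : Module.finrank Dᵐᵒᵖ V = k) :
    ∃ a : Fin k → D, (∀ i, a i + θ (a i) = 0) ∧ (diagonal θ a).IsSubform q := by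
  let v := Module.finBasisOfFinrankEq Dᵐᵒᵖ V hk
  choose a ha using fun i => θ.alt.mkQ_surjective (q (v i))
  refine ⟨a, fun i => by rw [← q.polar_self (ha i).symm, hq],
    isSubform_diagonal (v := v) ?_ (fun i j _ => hq _ _) fun i => (ha i).symm⟩
  refine (injective_iff_map_eq_zero _).2 fun d hd => funext fun i => MulOpposite.op_injective ?_
  exact Fintype.linearIndependent_iff.1 v.linearIndependent (fun i => MulOpposite.op (d i)) hd i

theorem HasType.exists_isSubform_diagonal {m n : ℕ} (hq : q.HasType m n)
    (hθ : ∃ b : D, b + θ b ≠ 0) :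
    ∃ (a : Fin m → D) (b : Fin n → D), (∀ i, a i + θ (a i) ≠ 0) ∧
      (∀ i, b i + θ (b i) = 0) ∧ (diagonal θ (Fin.append a b)).IsSubform q := by
  obtain ⟨V₁, V₂, _, _, _, _, _, _, q₁, q₂, hq₁, hm, hq₂, hn, hiso⟩ := hq
  obtain ⟨a, ha, hsub₁⟩ := hq₁.exists_isSubform_diagonal hθ hm.ge
  obtain ⟨b, hb, hsub₂⟩ := hq₂.exists_isSubform_diagonal hn
  have hsub := (isSubform_diagonal_append a b).trans (hsub₁.orthSum hsub₂)
  exact ⟨a, b, ha, hb, hsub.trans hiso.isSubform⟩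

end Subform

end QuadForm

end QuadraticForms

section Isotropy

variable {F : Type u} [Field F] [CharP F 2] {Q : Type v} [DivisionRing Q] [Algebra F Q]
  {γ : FInvolution F Q}

theorem FInvolution.add_map_eq_zero_iff (θ : FInvolution F Q) {a : Q} : a + θ a = 0 ↔ θ a = a := by
  have := charP_two_of_algebra F Q
  rw [CharTwo.add_eq_zero, eq_comm]

/-- Up to conjugation, the Artin–Schreier elements with nonsplit slot `c` all lie on the line
`i + F j` modulo `F`, hence three of them are linearly dependent modulo `F`. -/
theorem RealizesSymbols.exists_linear_relation (hQ : RealizesSymbols F Q) (hγ : γ.IsCanonical)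
    {δ : Fin 3 → F} {c : Fˣ} (hδ : ∀ i, δ i ∉ symbolKer (c : F)) :
    ∃ (x : Fin 3 → Q) (s : Fin 3 → F) (f : F), (∀ i, IsArtinSchreier γ (x i) (δ i)) ∧ s ≠ 0 ∧
      ∑ i, s i • x i = f • 1 := by
  obtain ⟨i, j, P⟩ := hQ _ c (hδ 0)
  have aligned : ∀ k, ∃ (x : Q) (p q : F), IsArtinSchreier γ x (δ k) ∧ x = i + p • 1 + q • j := by
    intro k
    obtain ⟨_, _, P'⟩ := hQ _ c (hδ k)
    obtain ⟨x, P'⟩ := P.exists_conj_right P'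
    obtain ⟨p, q, h⟩ := P.exists_eq_add P' hγ
    exact ⟨x, p, q, P'.isArtinSchreier hγ, h⟩
  choose x p q hx hxi using aligned
  obtain ⟨s, hs, hsum, hsq⟩ : ∃ s : Fin 3 → F, s ≠ 0 ∧ ∑ k, s k = 0 ∧ ∑ k, s k * q k = 0 := by
    simp only [Fin.sum_univ_three]
    by_cases hq : q 0 = q 1 ∧ q 1 = q 2
    · exact ⟨![1, 1, 0], fun h => one_ne_zero (congrFun h 0), by simp [CharTwo.add_self_eq_zero],
        by simp [hq, CharTwo.add_self_eq_zero]⟩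
    · refine ⟨![q 1 + q 2, q 2 + q 0, q 0 + q 1], fun h => hq ?_, ?_, ?_⟩
      · have h₁ := congrFun h 0
        have h₂ := congrFun h 2
        simp only [CharTwo.add_eq_zero, Matrix.cons_val, Pi.zero_apply] at h₁ h₂
        exact ⟨h₂, h₁⟩
      · simp only [Matrix.cons_val]
        grind
      · simp only [Matrix.cons_val]
        grind
  refine ⟨x, s, ∑ k, s k * p k, hx, hs, ?_⟩
  calc ∑ k, s k • x k = (∑ k, s k) • i + (∑ k, s k * p k) • 1 + (∑ k, s k * q k) • j := by
        simp only [hxi, Finset.sum_smul, ← Finset.sum_add_distrib, smul_add, smul_smul]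
    _ = (∑ k, s k * p k) • 1 := by rw [hsum, hsq, zero_smul, zero_smul, zero_add, add_zero]

variable [Algebra.IsCentral F Q]

theorem FInvolution.IsCanonical.mem_alt_iff (hγ : γ.IsCanonical) (hdim : Module.finrank F Q ≠ 1)
    {a : Q} : a ∈ γ.alt ↔ ∃ f : F, a = f • 1 := by
  have := charP_two_of_algebra F Q
  rw [γ.mem_alt]
  constructor
  · rintro ⟨b, rfl⟩
    obtain ⟨t, ht⟩ := hγ.exists_map_eq_add b
    exact ⟨t, by rw [ht, CharTwo.sub_eq_add, CharTwo.add_cancel_left]⟩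
  · rintro ⟨f, rfl⟩
    obtain ⟨a, c, i, j, P⟩ := hγ.exists_isSymbolPair hdim
    refine ⟨f • i, ?_⟩
    rw [map_smul, (P.isArtinSchreier hγ).map_eq, CharTwo.sub_eq_add, smul_add,
      CharTwo.add_cancel_left]

namespace IsArtinSchreier

variable {u x : Q} {δ : F}

theorem exists_conj_eq_smul (h : IsArtinSchreier γ u δ) (h' : IsArtinSchreier γ x δ)
    (hγ : γ.IsCanonical) :
    ∃ (g : Q) (n : F), n ≠ 0 ∧ γ g * g = n • 1 ∧ γ g * u * g = n • x := by
  obtain ⟨c, j, P⟩ := h'.exists_isSymbolPair hγ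
  obtain ⟨g, hg, hgx⟩ := exists_conj_of_mul_self (x := x) (y := u) (t := 1) (n := δ)
    (by rw [h'.mul_self, one_smul]) (by rw [h.mul_self, one_smul]) ⟨j, P.not_commute⟩
  obtain ⟨n, hn, hgg, -⟩ := hγ.exists_norm_ne_zero hg
  exact ⟨g, n, hn, hgg, by rw [mul_assoc, hgx, ← mul_assoc, hgg, smul_one_mul]⟩

/-- If `r` is a norm from `F(u)`, take `d` in `F(u)`. Otherwise write `Q = [δ, c)` with generators
`u` and `j`: then `r c` is a norm, and `d` can be found in `F(u) j`. -/
theorem exists_conj_self_eq_smul_add (hQ : RealizesSymbols F Q) (h : IsArtinSchreier γ u δ)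
    (hγ : γ.IsCanonical) (r : Fˣ) : ∃ (d : Q) (f : F), γ d * u * d = (r : F) • u + f • 1 := by
  obtain ⟨c, j, P⟩ := h.exists_isSymbolPair hγ
  by_cases hr : δ ∈ symbolKer (r : F)
  · obtain ⟨p, q, hpq⟩ := (mem_symbolKer_iff_exists_norm r.ne_zero).1 hr
    refine ⟨p • 1 + q • u, 0, ?_⟩
    simp only [map_add, map_smul, γ.map_one, h.map_eq, hpq, artinSchreierNorm, add_mul, mul_add,
      smul_mul_assoc, mul_smul_comm, one_mul, mul_one, h.mul_self]
    match_scalars <;> grind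
  · obtain ⟨p, q, hpq⟩ := (mem_symbolKer_iff_exists_norm (r * c).ne_zero).1
      (hQ.mem_symbolKer_mul hγ hr (P.notMem_symbolKer hγ))
    have hconj : γ ((p • 1 + q • u) * j) * u * ((p • 1 + q • u) * j) =
        (c * (r * c) : F) • (u + 1) := by
      simp only [γ.map_mul', map_add, map_smul, h.map_eq, P.map_right hγ,
        ← Units.val_mul, hpq, artinSchreierNorm, add_mul, mul_add, smul_mul_assoc, mul_smul_comm,
        one_mul, mul_one, mul_assoc, P.ii, P.ji, P.jj, P.ii_mul, P.ji_mul]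
      match_scalars <;> grind
    refine ⟨(c : F)⁻¹ • ((p • 1 + q • u) * j), r, ?_⟩
    have hc := c.ne_zero
    rw [map_smul, smul_mul_assoc, smul_mul_smul_comm, hconj]
    match_scalars <;> field_simp

theorem exists_conj_smul_eq_smul_add (hQ : RealizesSymbols F Q) (h : IsArtinSchreier γ u δ)
    (h' : IsArtinSchreier γ x δ) (hγ : γ.IsCanonical) {t : F} (ht : t ≠ 0) (s : F) :
    ∃ (d : Q) (f : F), (d = 0 → s = 0) ∧ γ d * (t • u) * d = s • x + f • 1 := by
  by_cases hs : s = 0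
  · exact ⟨0, 0, fun _ => hs, by simp [hs]⟩
  obtain ⟨g, n, hn, hgg, hg⟩ := h.exists_conj_eq_smul h' hγ
  obtain ⟨d, f, hd⟩ := h.exists_conj_self_eq_smul_add hQ hγ
    (Units.mk0 (s / (t * n)) (div_ne_zero hs (mul_ne_zero ht hn)))
  have hconj : γ (d * g) * (t • u) * (d * g) = s • x + (t * f * n) • 1 := by
    calc γ (d * g) * (t • u) * (d * g) = t • (γ g * (γ d * u * d) * g) := by
          simp only [γ.map_mul', mul_smul_comm, smul_mul_assoc, mul_assoc]
      _ = t • ((s / (t * n)) • (γ g * u * g) + f • (γ g * g)) := by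
          rw [hd, Units.val_mk0, mul_add, add_mul, mul_smul_comm, smul_mul_assoc, mul_smul_comm,
            smul_mul_assoc, mul_one]
      _ = s • x + (t * f * n) • 1 := by
          rw [hg, hgg]
          match_scalars <;> field_simp
  refine ⟨d * g, t * f * n, fun hdg => ?_, hconj⟩
  rw [hdg, mul_zero] at hconj
  rw [add_comm] at hconj
  exact (eq_zero_of_smul_add_smul_one h'.ne_smul_one hconj.symm).2

end IsArtinSchreier

namespace QuadForm

variable (hQ : RealizesSymbols F Q) (hγ : γ.IsCanonical) (hdim : Module.finrank F Q ≠ 1)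

section
include hγ hdim

theorem diagonal_eq_mkQ_iff {ι : Type*} [Fintype ι] {a d : ι → Q} {b : Q} :
    diagonal γ a d = γ.alt.mkQ b ↔ ∃ f : F, ∑ i, γ (d i) * a i * d i = b + f • 1 := by
  rw [diagonal_apply, ← sub_eq_zero, ← map_sub, γ.mkQ_eq_zero, hγ.mem_alt_iff hdim]
  simp only [sub_eq_iff_eq_add', mul_assoc]

theorem isotropic_diagonal_iff {ι : Type*} [Fintype ι] {a : ι → Q} :
    (diagonal γ a).Isotropic ↔
      ∃ d : ι → Q, d ≠ 0 ∧ ∃ f : F, ∑ i, γ (d i) * a i * d i = f • 1 := by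
  simp only [Isotropic, ← _root_.map_zero γ.alt.mkQ, diagonal_eq_mkQ_iff hγ hdim, zero_add]

end

section
include hQ hγ hdim

theorem isotropic_diagonal_of_sum_eq {ι : Type*} [Fintype ι] {t δ s : ι → F} {u x : ι → Q} {f : F}
    (ht : ∀ i, t i ≠ 0) (hu : ∀ i, IsArtinSchreier γ (u i) (δ i))
    (hx : ∀ i, IsArtinSchreier γ (x i) (δ i)) (hs : s ≠ 0) (hsum : ∑ i, s i • x i = f • 1) :
    (diagonal γ fun i => t i • u i).Isotropic := by
  choose d g hd hdg using fun i => (hu i).exists_conj_smul_eq_smul_add hQ (hx i) hγ (ht i) (s i)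
  refine (isotropic_diagonal_iff hγ hdim).2
    ⟨d, fun h => hs (funext fun i => hd i (congrFun h i)), f + ∑ i, g i, ?_⟩
  rw [Finset.sum_congr rfl fun i _ => hdg i, Finset.sum_add_distrib, hsum, ← Finset.sum_smul,
    add_smul]

end

end QuadForm

theorem sum_three_eq_rotate {M : Type*} [AddCommMonoid M] (g : Fin 3 → M) (k : Fin 3) :
    ∑ i, g i = g (k + 1) + g (k + 2) + g k := by
  rw [Fin.sum_univ_three]
  fin_cases k
  · exact add_rotate (g 0) (g 1) (g 2)
  · exact (add_rotate (g 2) (g 0) (g 1)).symm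
  · rfl

theorem IsArtinSchreier.sum_notMem_symbolRadical (hγ : γ.IsCanonical) {u : Fin 3 → Q}
    {δ s : Fin 3 → F} {f : F} (hu : ∀ i, IsArtinSchreier γ (u i) (δ i)) (hs : s ≠ 0)
    (h : ∑ i, s i • u i = f • 1) : ∑ i, δ i ∉ symbolRadical F := by
  obtain ⟨k, hk⟩ := Function.ne_iff.1 hs
  rw [sum_three_eq_rotate _ k] at h ⊢
  exact ((hu (k + 1)).add_add (hu (k + 2)) (hu k) hk h).notMem_symbolRadical hγ

namespace QuadForm

variable (hQ : RealizesSymbols F Q) (hγ : γ.IsCanonical) (hdim : Module.finrank F Q ≠ 1)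
include hQ hγ hdim

theorem isotropic_diagonal_three_iff {t δ : Fin 3 → F} {u : Fin 3 → Q} (ht : ∀ i, t i ≠ 0)
    (hu : ∀ i, IsArtinSchreier γ (u i) (δ i)) :
    (diagonal γ fun i => t i • u i).Isotropic ↔ ∑ i, δ i ∉ symbolRadical F := by
  constructor
  · intro hiso
    obtain ⟨d, hd, f, hf⟩ := (isotropic_diagonal_iff hγ hdim).1 hiso
    have conj : ∀ i, ∃ (x : Q) (s : F), IsArtinSchreier γ x (δ i) ∧ (s = 0 → d i = 0) ∧
        γ (d i) * (t i • u i) * d i = s • x := by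
      intro i
      by_cases hdi : d i = 0
      · exact ⟨u i, 0, hu i, fun _ => hdi, by rw [hdi, mul_zero, zero_smul]⟩
      · obtain ⟨s, x, hs, hx, h⟩ := (hu i).exists_conj hγ hdi
        refine ⟨x, t i * s, hx, fun h0 => absurd h0 (mul_ne_zero (ht i) hs), ?_⟩
        rw [mul_smul_comm, smul_mul_assoc, h, smul_smul]
    choose x s hx hs hsx using conj
    rw [Finset.sum_congr rfl fun i _ => hsx i] at hf
    exact IsArtinSchreier.sum_notMem_symbolRadical hγ hx
      (fun h => hd (funext fun i => hs i (congrFun h i))) hf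
  · intro hδ
    rw [Fin.sum_univ_three] at hδ
    obtain ⟨c, h₀, h₁, h₂⟩ := (hQ.isTwoValuedSymbol hγ).exists_notMem_triple
      ((hu 0).notMem_symbolRadical hγ) ((hu 1).notMem_symbolRadical hγ)
      ((hu 2).notMem_symbolRadical hγ) hδ
    obtain ⟨x, s, f, hx, hs, hsum⟩ := hQ.exists_linear_relation hγ (δ := δ) (c := c)
      (by simp only [Fin.forall_fin_succ, Fin.succ_zero_eq_one, Fin.succ_one_eq_two, h₀, h₁, h₂,
        not_false_eq_true, IsEmpty.forall_iff, and_self])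
    exact isotropic_diagonal_of_sum_eq hQ hγ hdim ht hu hx hs hsum

end QuadForm

end Isotropy

section DiagonalAppend

variable {F : Type u} [Field F] {D : Type v} [DivisionRing D] [Algebra F D] {θ : FInvolution F D}

namespace QuadForm

theorem isotropic_diagonal_append {m n : ℕ} {a x : Fin m → D} {b y : Fin n → D}
    (hxy : x ≠ 0 ∨ y ≠ 0) (h : diagonal θ a x + diagonal θ b y = 0) :
    (diagonal θ (Fin.append a b)).Isotropic := by
  refine ⟨Fin.append x y, fun h0 => ?_, by rw [diagonal_append, h]⟩
  have hx : x = 0 := funext fun i => (Fin.append_left x y i).symm.trans (congrFun h0 _)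
  have hy : y = 0 := funext fun i => (Fin.append_right x y i).symm.trans (congrFun h0 _)
  exact hxy.elim (· hx) (· hy)

theorem isotropic_or_exists_eq_neg_of_isotropic_append {m : ℕ} {a : Fin m → D} {b : Fin 1 → D}
    (h : (diagonal θ (Fin.append a b)).Isotropic) :
    (diagonal θ a).Isotropic ∨ ∃ d, diagonal θ a d = -θ.alt.mkQ (b 0) := by
  obtain ⟨z, hz0, hz⟩ := h
  rw [← Fin.append_castAdd_natAdd (f := z)] at hz0 hz
  set x := fun i => z (Fin.castAdd 1 i)
  set y := fun i => z (Fin.natAdd m i)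
  rw [diagonal_append, add_eq_zero_iff_eq_neg] at hz
  by_cases hy : y 0 = 0
  · have hy' : y = 0 := funext (Fin.forall_fin_one.2 hy)
    rw [hy', (diagonal θ b).map_zero, neg_zero] at hz
    refine Or.inl ⟨x, fun hx => hz0 (funext (Fin.addCases (fun i => ?_) fun i => ?_)), hz⟩
    · rw [Fin.append_left, hx, Pi.zero_apply, Pi.zero_apply]
    · rw [Fin.append_right, hy', Pi.zero_apply, Pi.zero_apply]
  · refine Or.inr ⟨x <• (y 0)⁻¹, ?_⟩
    have hinv : θ (y 0)⁻¹ * θ (y 0) = 1 := by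
      rw [← θ.map_mul', mul_inv_cancel₀ hy, θ.map_one]
    rw [smul', hz, diagonal_apply, Fin.sum_univ_one, map_neg, θ.conj_mkQ, mul_assoc (θ (y 0)),
      mul_assoc (b 0), mul_inv_cancel₀ hy, mul_one, ← mul_assoc, hinv, one_mul]

theorem isotropic_diagonal_append_of_add_single {m : ℕ} {a : Fin m → D} {b : Fin 1 → D} (k : Fin m)
    (d : D) (h : (diagonal θ (a + Pi.single k (θ d * (b 0 * d)))).Isotropic) :
    (diagonal θ (Fin.append a b)).Isotropic := by
  obtain ⟨x, hx0, hx⟩ := h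
  refine isotropic_diagonal_append (y := fun _ => d * x k) (Or.inl hx0) (Eq.trans ?_ hx)
  simp only [diagonal_apply, Pi.add_apply, add_mul, mul_add, Finset.sum_add_distrib, map_add]
  have sum_single : ∑ i, θ (x i) * ((Pi.single k (θ d * (b 0 * d)) : Fin m → D) i * x i) =
      θ (x k) * (θ d * (b 0 * d) * x k) := by
    rw [Fintype.sum_eq_single k fun i hi => by rw [Pi.single_eq_of_ne hi, zero_mul, mul_zero],
      Pi.single_eq_same]
  rw [Fin.sum_univ_one, sum_single, θ.map_mul']
  simp only [mul_assoc]

end QuadForm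

end DiagonalAppend

section Quaternary

variable {F : Type u} [Field F] [CharP F 2] {Q : Type v} [DivisionRing Q] [Algebra F Q]
  [Algebra.IsCentral F Q] {γ : FInvolution F Q}

namespace IsArtinSchreier

variable {u w : Q} {δ : F}

omit [Algebra.IsCentral F Q] in
theorem smul_one_eq (h : IsArtinSchreier γ u δ) : δ • (1 : Q) = u * u + u := by
  have := charP_two_of_algebra F Q
  rw [h.mul_self, add_right_comm, CharTwo.add_self_eq_zero, zero_add]

omit [CharP F 2] [Algebra.IsCentral F Q] in
theorem map_ne (h : IsArtinSchreier γ u δ) : γ u ≠ u := by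
  rw [h.map_eq, ne_eq, add_eq_left]
  exact one_ne_zero

omit [Algebra.IsCentral F Q] in
theorem sum_add_conj {e : Q} {δ₁ δ₂ δ₃ τ : F} (h : IsArtinSchreier γ u δ)
    (h₁ : IsArtinSchreier γ (u + w) δ₁) (h₂ : IsArtinSchreier γ (u + e * (w * e)) δ₂)
    (h₃ : IsArtinSchreier γ (u + (1 + e) * (w * (1 + e))) δ₃) (hwe : w * e = e * w + τ • 1) :
    δ + δ₁ + δ₂ + δ₃ = τ := by
  have hlin : u + (1 + e) * (w * (1 + e)) = u + w + e * (w * e) + τ • 1 := by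
    rw [mul_add, mul_one, add_mul, one_mul, mul_add, hwe]
    match_scalars <;> grind
  have hquad : w * (e * (w * e)) + e * (w * e) * w = (τ * τ) • 1 := by
    calc w * (e * (w * e)) + e * (w * e) * w = (w * e) * (w * e) + (e * w) * (e * w) := by
          simp only [mul_assoc]
      _ = (τ * τ) • 1 := by
          rw [hwe]
          simp only [add_mul, mul_add, smul_mul_assoc, mul_smul_comm, one_mul, mul_one]
          match_scalars <;> grind
  apply smul_one_injective (F := F) (Q := Q)
  simp only
  rw [add_smul, add_smul, add_smul, h.smul_one_eq, h₁.smul_one_eq, h₂.smul_one_eq, h₃.smul_one_eq,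
    hlin]
  linear_combination (norm := skip) hquad
  simp only [add_mul, mul_add, smul_mul_assoc, mul_smul_comm, one_mul, mul_one, mul_assoc]
  match_scalars <;> grind

theorem exists_add_conj (h : IsArtinSchreier γ u δ) (hγ : γ.IsCanonical) (hw : γ w = w)
    (hwF : ∀ f : F, w ≠ f • 1) (δ' : F) :
    ∃ (d : Q) (ε : F), IsArtinSchreier γ (u + γ d * (w * d)) ε ∧ ε + δ' ∉ symbolRadical F := by
  have exists_ε : ∀ d : Q, ∃ ε, IsArtinSchreier γ (u + γ d * (w * d)) ε := fun d =>
    hγ.exists_isArtinSchreier (by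
      rw [map_add, h.map_eq, γ.map_mul', γ.map_mul', γ.invol', hw, mul_assoc]
      abel)
  choose ε hε using exists_ε
  by_contra! hrad
  obtain ⟨e, he, hwe⟩ := exists_map_eq_and_mul_eq_mul_add hγ hw hwF δ
  have hsum : ε 0 + ε 1 + ε e + ε (1 + e) = δ := by
    have h₀ := hε 0
    have h₁ := hε 1
    have h₂ := hε e
    have h₃ := hε (1 + e)
    rw [mul_zero, mul_zero, add_zero] at h₀
    rw [γ.map_one, mul_one, one_mul] at h₁
    rw [he] at h₂
    rw [map_add, γ.map_one, he] at h₃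
    exact h₀.sum_add_conj h₁ h₂ h₃ hwe
  refine h.notMem_symbolRadical hγ ?_
  have hmem := add_mem (add_mem (hrad 0 _ (hε 0)) (hrad 1 _ (hε 1)))
    (add_mem (hrad e _ (hε e)) (hrad _ _ (hε (1 + e))))
  rw [← hsum]
  convert hmem using 1
  grind

end IsArtinSchreier

namespace QuadForm

variable (hQ : RealizesSymbols F Q) (hγ : γ.IsCanonical) (hdim : Module.finrank F Q ≠ 1)
include hQ hγ hdim

theorem isotropic_diagonal_two_or_exists_eq {t δ : Fin 2 → F} {u : Fin 2 → Q} {v : Q} {ε : F}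
    (ht : ∀ i, t i ≠ 0) (hu : ∀ i, IsArtinSchreier γ (u i) (δ i)) (hv : IsArtinSchreier γ v ε)
    (h : ∑ i, δ i + ε ∉ symbolRadical F) :
    (diagonal γ fun i => t i • u i).Isotropic ∨
      ∃ d, diagonal γ (fun i => t i • u i) d = -γ.alt.mkQ v := by
  refine isotropic_or_exists_eq_neg_of_isotropic_append (b := fun _ => v) ?_
  have hiso := (isotropic_diagonal_three_iff hQ hγ hdim (t := ![t 0, t 1, 1])
    (u := ![u 0, u 1, v]) (δ := ![δ 0, δ 1, ε]) ?_ ?_).2 ?_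
  · convert hiso using 2
    funext i
    fin_cases i
    · rfl
    · rfl
    · exact (one_smul F v).symm
  · simp [Fin.forall_fin_succ, ht]
  · simp [Fin.forall_fin_succ, hu, hv]
  · simpa [Fin.sum_univ_three] using h

theorem isotropic_diagonal_append_two_two {a b : Fin 2 → Q} (ha : ∀ i, a i + γ (a i) ≠ 0)
    (hb : ∀ i, b i + γ (b i) ≠ 0) : (diagonal γ (Fin.append a b)).Isotropic := by
  choose t u δ ht hu hau using fun i =>
    hγ.exists_eq_smul_of_map_ne (mt γ.add_map_eq_zero_iff.2 (ha i))
  choose s v ε hs hv hbv using fun i =>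
    hγ.exists_eq_smul_of_map_ne (mt γ.add_map_eq_zero_iff.2 (hb i))
  obtain rfl : a = fun i => t i • u i := funext hau
  obtain rfl : b = fun i => s i • v i := funext hbv
  obtain ⟨η, hη, hη₁, hη₂⟩ :=
    exists_notMem_symbolRadical_add_add hγ hdim (∑ i, δ i) (∑ i, ε i)
  obtain ⟨w, hw⟩ := hQ.exists_isArtinSchreier hγ hη
  rcases isotropic_diagonal_two_or_exists_eq hQ hγ hdim ht hu hw hη₁ with ⟨x, hx0, hx⟩ | ⟨x, hx⟩
  · exact isotropic_diagonal_append (y := 0) (Or.inl hx0) (by rw [hx, map_zero, add_zero])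
  rcases isotropic_diagonal_two_or_exists_eq hQ hγ hdim hs hv hw hη₂ with ⟨y, hy0, hy⟩ | ⟨y, hy⟩
  · exact isotropic_diagonal_append (x := 0) (Or.inr hy0) (by rw [hy, map_zero, add_zero])
  refine isotropic_diagonal_append (x := x) (y := y) (Or.inl ?_) ?_
  · rintro rfl
    rw [map_zero, eq_comm, neg_eq_zero, γ.mkQ_eq_zero, hγ.mem_alt_iff hdim] at hx
    obtain ⟨f, hf⟩ := hx
    exact hw.ne_smul_one f hf
  · have := charP_two_of_algebra F Q
    rw [hx, hy, ← map_neg, ← map_add, CharTwo.add_self_eq_zero, _root_.map_zero]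

theorem isotropic_diagonal_append_three_one {a : Fin 3 → Q} {b : Fin 1 → Q}
    (ha : ∀ i, a i + γ (a i) ≠ 0) (hb : b 0 + γ (b 0) = 0) :
    (diagonal γ (Fin.append a b)).Isotropic := by
  by_cases hbF : ∃ f : F, b 0 = f • 1
  · refine isotropic_diagonal_append (x := 0) (y := 1) (Or.inr one_ne_zero) ?_
    rw [map_zero, zero_add, diagonal_apply, Fin.sum_univ_one, Pi.one_apply, γ.map_one, one_mul,
      mul_one, γ.mkQ_eq_zero, hγ.mem_alt_iff hdim]
    exact hbF
  choose t u δ ht hu hau using fun i =>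
    hγ.exists_eq_smul_of_map_ne (mt γ.add_map_eq_zero_iff.2 (ha i))
  have hw : γ ((t 2)⁻¹ • b 0) = (t 2)⁻¹ • b 0 := by rw [map_smul, γ.add_map_eq_zero_iff.1 hb]
  have hwF : ∀ f : F, (t 2)⁻¹ • b 0 ≠ f • 1 := fun f hf =>
    hbF ⟨t 2 * f, by rw [mul_smul, ← hf, smul_inv_smul₀ (ht 2)]⟩
  obtain ⟨d, ε, hε, hεδ⟩ := (hu 2).exists_add_conj hγ hw hwF (δ 0 + δ 1)
  refine isotropic_diagonal_append_of_add_single 2 d ?_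
  have hiso := (isotropic_diagonal_three_iff hQ hγ hdim (t := t)
    (u := ![u 0, u 1, u 2 + γ d * ((t 2)⁻¹ • b 0 * d)]) (δ := ![δ 0, δ 1, ε]) ht ?_).2 ?_
  · convert hiso using 2 with i
    funext i
    fin_cases i
    · simp [hau]
    · simp [hau]
    · simp [hau, ht]
  · simpa [Fin.forall_fin_succ, hu] using hε
  · simpa [Fin.sum_univ_three, add_comm] using hεδ

omit hQ in
theorem _root_.FInvolution.IsCanonical.exists_add_map_ne_zero : ∃ b : Q, b + γ b ≠ 0 := by
  obtain ⟨a, c, i, j, P⟩ := hγ.exists_isSymbolPair hdim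
  exact ⟨i, mt γ.add_map_eq_zero_iff.1 (P.isArtinSchreier hγ).map_ne⟩

variable {V : Type w} [AddCommGroup V] [Module Qᵐᵒᵖ V] {q : QuadForm γ V}

theorem Nonsingular.isotropic_of_four_le_finrank (hq : q.Nonsingular)
    (hV : 4 ≤ Module.finrank Qᵐᵒᵖ V) : q.Isotropic := by
  obtain ⟨a, ha, hsub⟩ := hq.exists_isSubform_diagonal (hγ.exists_add_map_ne_zero hdim) hV
  refine hsub.isotropic ?_
  rw [← Fin.append_castAdd_natAdd (m := 2) (n := 2) (f := a)]
  exact isotropic_diagonal_append_two_two hQ hγ hdim (fun i => ha _) fun i => ha _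

theorem HasType.isotropic_of_four_zero (hq : q.HasType 4 0) : q.Isotropic := by
  obtain ⟨V₁, V₂, _, _, _, _, _, _, q₁, q₂, hq₁, hV₁, -, -, hiso⟩ := hq
  exact ((isSubform_orthSum_left q₁ q₂).trans hiso.isSubform).isotropic
    (hq₁.isotropic_of_four_le_finrank hQ hγ hdim hV₁.ge)

theorem HasType.isotropic_of_three_one (hq : q.HasType 3 1) : q.Isotropic := by
  obtain ⟨a, b, ha, hb, hsub⟩ := hq.exists_isSubform_diagonal (hγ.exists_add_map_ne_zero hdim)
  exact hsub.isotropic (isotropic_diagonal_append_three_one hQ hγ hdim ha (hb 0))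

theorem exists_nonsingular_not_isotropic_fin_three :
    ∃ q : QuadForm γ (Fin 3 → Q), q.Nonsingular ∧ ¬q.Isotropic := by
  obtain ⟨δ, c, u, j, P⟩ := hγ.exists_isSymbolPair hdim
  obtain ⟨ε, hε, hδε⟩ := exists_notMem_symbolRadical_add hγ hdim δ
  obtain ⟨v, hv⟩ := hQ.exists_isArtinSchreier hγ hε
  obtain ⟨w, hw⟩ := hQ.exists_isArtinSchreier hγ hδε
  have hu : ∀ i, IsArtinSchreier γ (![u, v, w] i) (![δ, ε, δ + ε] i) := by
    simp [Fin.forall_fin_succ, P.isArtinSchreier hγ, hv, hw]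
  refine ⟨diagonal γ fun i => (1 : F) • ![u, v, w] i, diagonal_nonsingular fun i => ?_, ?_⟩
  · rw [one_smul, ne_eq, γ.add_map_eq_zero_iff]
    exact (hu i).map_ne
  · rw [isotropic_diagonal_three_iff hQ hγ hdim (fun _ => one_ne_zero) hu, not_not,
      Fin.sum_univ_three]
    simp [CharTwo.add_self_eq_zero]

end QuadForm

end Quaternary

section ArbitraryInvolution

variable {F : Type u} [Field F] {D : Type v} [DivisionRing D] [Algebra F D]
  {θ θ' : FInvolution F D} {u : D}

/-- The `θ`-symmetric element `u` turns `θ` into `θ' = Int(u) ∘ θ`, so that left multiplication by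
`u` turns forms over `(D, θ)` into forms over `(D, θ')`. -/
structure FInvolution.IsScaling (θ θ' : FInvolution F D) (u : D) : Prop where
  ne_zero : u ≠ 0
  map_eq : θ u = u
  map_mul_eq : ∀ x, θ' x * u = u * θ x

namespace FInvolution.IsScaling

theorem map_eq' (h : θ.IsScaling θ' u) : θ' u = u :=
  mul_right_cancel₀ h.ne_zero (by rw [h.map_mul_eq, h.map_eq])

theorem symm (h : θ.IsScaling θ' u) : θ'.IsScaling θ u⁻¹ where
  ne_zero := inv_ne_zero h.ne_zero
  map_eq := by
    have hmul := θ'.map_mul' u u⁻¹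
    rw [mul_inv_cancel₀ h.ne_zero, θ'.map_one, h.map_eq'] at hmul
    exact eq_inv_of_mul_eq_one_left hmul.symm
  map_mul_eq x := by
    rw [eq_inv_mul_iff_mul_eq₀ h.ne_zero, ← mul_assoc, ← h.map_mul_eq,
      mul_inv_cancel_right₀ h.ne_zero]

theorem mul_mem_alt (h : θ.IsScaling θ' u) {a : D} (ha : a ∈ θ.alt) : u * a ∈ θ'.alt := by
  obtain ⟨b, rfl⟩ := θ.mem_alt.1 ha
  exact θ'.mem_alt.2 ⟨u * b, by rw [θ'.map_mul', h.map_eq', h.map_mul_eq, mul_sub]⟩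

end FInvolution.IsScaling

variable {V : Type w} [AddCommGroup V] [Module Dᵐᵒᵖ V]

/-- The hermitian form `u f` over `(D, θ')`. -/
def HermForm.scale (f : HermForm θ V) (h : θ.IsScaling θ' u) : HermForm θ' V where
  toFun x y := u * f x y
  add_left' x y z := by rw [f.add_left', mul_add]
  add_right' x y z := by rw [f.add_right', mul_add]
  smul' x y c d := by simp only [f.smul', ← mul_assoc, h.map_mul_eq]
  symm' x y := by rw [θ'.map_mul', h.map_eq', h.map_mul_eq, ← f.symm']

namespace QuadForm

/-- The quadratic form `u q` over `(D, θ')`. -/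
def scale (q : QuadForm θ V) (h : θ.IsScaling θ' u) : QuadForm θ' V where
  toFun x := θ.alt.mapQ θ'.alt (LinearMap.mulLeft F u) (fun _ => h.mul_mem_alt) (q x)
  smul' x d := by
    obtain ⟨a, ha⟩ := θ.alt.mkQ_surjective (q x)
    rw [q.smul', ← ha, θ.conj_mkQ]
    refine congrArg θ'.alt.mkQ (?_ : u * (θ d * (a * d)) = θ' d * (u * a * d))
    simp only [← mul_assoc, h.map_mul_eq]
  exists_polar' := by
    refine ⟨q.polar.scale h, fun x y => ?_⟩
    rw [← map_sub, ← map_sub, q.polar_spec]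
    rfl

theorem scale_eq_mkQ (h : θ.IsScaling θ' u) {q : QuadForm θ V} {x : V} {a : D}
    (ha : q x = θ.alt.mkQ a) : q.scale h x = θ'.alt.mkQ (u * a) := by
  change θ.alt.mapQ θ'.alt (LinearMap.mulLeft F u) (fun _ => h.mul_mem_alt) (q x) = _
  rw [ha]
  rfl

theorem polar_scale (h : θ.IsScaling θ' u) (q : QuadForm θ V) (x y : V) :
    (q.scale h).polar x y = u * q.polar x y := by
  refine ((q.scale h).polar_unique (q.polar.scale h) (fun x y => ?_) x y).symm
  change θ.alt.mapQ θ'.alt (LinearMap.mulLeft F u) (fun _ => h.mul_mem_alt) (q (x + y)) -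
    θ.alt.mapQ θ'.alt _ _ (q x) - θ.alt.mapQ θ'.alt _ _ (q y) = _
  rw [← map_sub, ← map_sub, q.polar_spec]
  rfl

theorem Nonsingular.scale {q : QuadForm θ V} (hq : q.Nonsingular) (h : θ.IsScaling θ' u) :
    (q.scale h).Nonsingular := fun x hx => hq x fun y => by
  have hxy := hx y
  rw [polar_scale] at hxy
  exact (mul_eq_zero.1 hxy).resolve_left h.ne_zero

theorem Isotropic.of_scale {q : QuadForm θ V} {h : θ.IsScaling θ' u}
    (hq : (q.scale h).Isotropic) : q.Isotropic := by
  obtain ⟨x, hx0, hx⟩ := hq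
  obtain ⟨a, ha⟩ := θ.alt.mkQ_surjective (q x)
  rw [scale_eq_mkQ h ha.symm, θ'.mkQ_eq_zero] at hx
  have ha_mem := h.symm.mul_mem_alt hx
  rw [inv_mul_cancel_left₀ h.ne_zero] at ha_mem
  exact ⟨x, hx0, by rw [← ha, θ.mkQ_eq_zero]; exact ha_mem⟩

end QuadForm

theorem uTilde_le_of_isScaling (h : θ.IsScaling θ' u) : uTilde θ ≤ uTilde θ' := by
  refine sSup_le ?_
  rintro n ⟨V, _, _, _, q, hq, hiso, rfl⟩
  exact le_sSup ⟨V, _, _, ‹_›, q.scale h, hq.scale h, mt QuadForm.Isotropic.of_scale hiso, rfl⟩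

theorem uTilde_eq_of_isScaling (h : θ.IsScaling θ' u) : uTilde θ = uTilde θ' :=
  (uTilde_le_of_isScaling h).antisymm (uTilde_le_of_isScaling h.symm)

variable [CharP F 2] [Algebra.IsCentral F D] {γ : FInvolution F D}

namespace FInvolution.IsCanonical

theorem map_eq_of_map_mul_eq (hγ : γ.IsCanonical) (h : ∀ x, θ x * u = u * γ x) : γ u = u := by
  obtain ⟨t, ht⟩ := hγ.exists_map_eq_add u
  have commute_or : ∀ x, u * γ (θ x) = x * u := fun x => by rw [← h, θ.invol']
  have smul_eq : ∀ x, t • γ (θ x) = t • x := fun x => by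
    have hx := congrArg γ (h x)
    rw [γ.map_mul', γ.map_mul', γ.invol', ht, add_mul, mul_add, commute_or, smul_one_mul,
      mul_smul_comm, mul_one] at hx
    exact add_left_cancel hx
  obtain rfl | ht0 := eq_or_ne t 0
  · rw [ht, zero_smul, add_zero]
  · obtain ⟨r, rfl⟩ := exists_eq_smul_one_of_commute (F := F) (x := u) fun x => by
      rw [← commute_or, smul_right_injective D ht0 (smul_eq x)]
    exact γ.map_smul_one r

theorem exists_isScaling (hγ : γ.IsCanonical) (hdim : Module.finrank F D ≠ 1)
    (θ : FInvolution F D) : ∃ u, γ.IsScaling θ u := by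
  obtain ⟨a, c, i, j, P⟩ := hγ.exists_isSymbolPair hdim
  obtain ⟨u, hu, hi, hj⟩ := (P.map γ).exists_conj (P.map θ)
  have map_span : ∀ p q : F, θ (p • 1 + q • i) * u = u * γ (p • 1 + q • i) := fun p q => by
    simp only [map_add, map_smul, θ.map_one, γ.map_one, mul_add, add_mul, smul_mul_assoc,
      mul_smul_comm, hi, one_mul, mul_one]
  have map_mul_eq : ∀ x, θ x * u = u * γ x := fun x => by
    obtain ⟨p, q, r, s, rfl⟩ := P.exists_eq_add_mul hγ x
    rw [map_add θ.toLinearMap, map_add γ.toLinearMap, θ.map_mul', γ.map_mul', add_mul, mul_add,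
      map_span, mul_assoc, map_span, ← mul_assoc, hj, mul_assoc]
  exact ⟨u, hu, hγ.map_eq_of_map_mul_eq map_mul_eq, map_mul_eq⟩

theorem uTilde_eq_three (hγ : γ.IsCanonical) (hD : RealizesSymbols F D)
    (hdim : Module.finrank F D ≠ 1) : uTilde γ = 3 := by
  apply le_antisymm
  · refine sSup_le ?_
    rintro n ⟨V, _, _, _, q, hq, hiso, rfl⟩
    by_contra! hlt
    exact hiso (hq.isotropic_of_four_le_finrank hD hγ hdim
      (by exact_mod_cast Order.add_one_le_of_lt hlt))
  · obtain ⟨q, hq, hiso⟩ := QuadForm.exists_nonsingular_not_isotropic_fin_three hD hγ hdim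
    refine le_sSup ⟨Fin 3 → D, _, _, inferInstance, q, hq, hiso, ?_⟩
    rw [finrank_mulOpposite_pi, Fintype.card_fin]
    rfl

end FInvolution.IsCanonical

end ArbitraryInvolution

theorem mainTheorem9 {F : Type u} [Field F] [CharP F 2] (hF : IsKaplanskyField F)
    {Q : Type v} [DivisionRing Q] [Algebra F Q] (hQ : IsQuaternionAlgebra F Q)
    (γ : FInvolution F Q) (hγ : γ.IsCanonical) :
    (∀ (V : Type w) [AddCommGroup V] [Module Qᵐᵒᵖ V] [Module.Finite Qᵐᵒᵖ V] (ρ : QuadForm γ V),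
      ρ.HasType 4 0 ∨ ρ.HasType 3 1 → ρ.Isotropic) ∧
    ∀ θ : FInvolution F Q, uTilde θ = 3 := by
  have := hQ.central
  have hdim : Module.finrank F Q ≠ 1 := by simp [hQ.finrank_eq]
  have hsymb := hF.realizesSymbols hQ
  refine ⟨fun V _ _ _ ρ hρ => ?_, fun θ => ?_⟩
  · exact hρ.elim (·.isotropic_of_four_zero hsymb hγ hdim) (·.isotropic_of_three_one hsymb hγ hdim)
  · obtain ⟨u, hu⟩ := hγ.exists_isScaling hdim θ
    rw [← uTilde_eq_of_isScaling hu, hγ.uTilde_eq_three hsymb hdim]
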